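/- Let $T>0$, $r\in\mathbb{R}$, $v>0$, $\sigma>0$, $x_1\in\mathbb{R}$, $\alpha_1,\alpha_2>0$, and let $W$ be a standard Brownian motion. For $i=1,2$ let $\bar P_i(t)=\frac{v}{\alpha_i\sigma^2}\mathrm{e}^{r(t-T)}$, $t\in[0,T]$, be the rational decisions of the retail investor ($i=1$) and of the leading expert ($i=2$). For $\theta>0$ consider the retail investor's problem (Problem 3): maximize $$\mathbb{E}\Big[-\tfrac{1}{\alpha_1}\mathrm{e}^{-\alpha_1X_1(T)}\Big]-\frac{\theta}{2}\int_0^T\big[\dot P_1(t)-\dot{\bar P}_2(t)\big]^2\,\mathrm{d}t$$ over all deterministic $P_1\in C^1([0,T])$ with $P_1(0)=\frac{v}{\alpha_1\sigma^2}\mathrm{e}^{-rT}$ and $P_1(T)=\frac{v}{\alpha_1\sigma^2}$, where $\mathrm{d}X_1(t)=[rX_1(t)+vP_1(t)]\,\mathrm{d}t+\sigma P_1(t)\,\mathrm{d}W(t)$ and $X_1(0)=x_1$. Then an optimal decision $P_{1,\theta}^*$ exists for every $\theta>0$, the limit $P_{1\infty}^*(t):=\lim_{\theta\to\infty}P_{1,\theta}^*(t)$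 exists for every $t\in[0,T]$ and does not depend on the choice of the optimal decisions, and for all $t\in[0,T]$ $$P_{1\infty}^*(t)\ge\bar P_1(t)>\bar P_2(t)\ \text{ if }\alpha_1<\alpha_2,\qquad P_{1\infty}^*(t)\le\bar P_1(t)<\bar P_2(t)\ \text{ if }\alpha_1>\alpha_2 .$$ Consequently, if $\alpha_1\neq\alpha_2$, then $|P_{1\infty}^*(t)-\bar P_2(t)|>|P_{1\infty}^*(t)-\bar P_1(t)|$ for all $t\in[0,T]$. -/

import Mathlib

open MeasureTheory ProbabilityTheory Filter Topology Set
open scoped NNReal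

noncomputable section

namespace DecisionImitation

/-- The data of the market and of the two investors: interest rate `r`, excess return rate `v`,
volatility `σ`, length `T` of the investment period, initial wealth `x₁` of the retail investor,
risk aversion coefficients `α₁` (retail investor) and `α₂` (leading expert). -/
structure Model where
  r : ℝ
  v : ℝ
  σ : ℝ
  T : ℝ
  x₁ : ℝ
  α₁ : ℝ
  α₂ : ℝ

/-- Constant absolute risk aversion utility `φ(x) = -(1/α) e^{-αx}`. -/
def utility (α x : ℝ) : ℝ := -(1 / α) * Real.exp (-α * x)

/-- The rational decision `v / (α σ²) e^{r (t - T)}` of an investor with risk aversion `α`. -/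
def Model.rational (m : Model) (α t : ℝ) : ℝ :=
  m.v / (α * m.σ ^ 2) * Real.exp (m.r * (t - m.T))

/-- Derivative on `[0, T]` (one-sided at the end points). -/
def Model.rate (m : Model) (P : ℝ → ℝ) (t : ℝ) : ℝ := derivWithin P (Icc 0 m.T) t

/-- Integral disparity of two decision-changing rates: `½ ∫₀ᵀ (p - q)² dt`. -/
def Model.disparity (m : Model) (p q : ℝ → ℝ) : ℝ :=
  1 / 2 * ∫ t in (0 : ℝ)..m.T, (p t - q t) ^ 2

section Wealth

variable {Ω : Type*} [MeasurableSpace Ω]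

/-- `M` is the stochastic integral process `M t = ∫₀ᵗ H dW`, `0 ≤ t ≤ T`, of the (deterministic,
continuous) integrand `H`: it has continuous paths, and `M t` is the limit in probability of the
left-point sums `∑ H(t_k) (W(t_{k+1}) - W(t_k))` over the partition of `[0, t]` into `n` equal
parts. -/
structure IsItoIntegral (W : ℝ≥0 → Ω → ℝ) (μ : Measure Ω) (T : ℝ) (H : ℝ → ℝ)
    (M : ℝ → Ω → ℝ) : Prop where
  cont : ∀ᵐ ω ∂μ, ContinuousOn (fun t => M t ω) (Icc 0 T)
  tendsto : ∀ t ∈ Icc 0 T, TendstoInMeasure μ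
    (fun (n : ℕ) (ω : Ω) => ∑ k ∈ Finset.range n, H (t * (k : ℝ) / (n : ℝ)) *
      (W (t * ((k : ℝ) + 1) / (n : ℝ)).toNNReal ω - W (t * (k : ℝ) / (n : ℝ)).toNNReal ω))
    atTop (M t)

/-- `X` is the wealth process of the retail investor for the decision `P`, i.e. the solution of
`dX = (r X + v P) dt + σ P dW`, `X(0) = x₁`, on `[0, T]`. -/
def Model.IsWealth (m : Model) (W : ℝ≥0 → Ω → ℝ) (μ : Measure Ω) (P : ℝ → ℝ)
    (X : ℝ → Ω → ℝ) : Prop :=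
  ∃ M : ℝ → Ω → ℝ, IsItoIntegral W μ m.T (fun t => m.σ * P t) M ∧
    ∀ᵐ ω ∂μ, ContinuousOn (fun t => X t ω) (Icc 0 m.T) ∧
      ∀ t ∈ Icc 0 m.T,
        X t ω = m.x₁ + (∫ s in (0 : ℝ)..t, (m.r * X s ω + m.v * P s)) + M t ω

/-- Admissible decisions satisfying the boundary conditions: continuously differentiable on
`[0, T]`, and equal to the retail investor's rational decision at times `0` and `T`. -/
structure Model.Feasible (m : Model) (P : ℝ → ℝ) : Prop where
  contDiff : ContDiffOn ℝ 1 P (Icc 0 m.T)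
  initial : P 0 = m.v / (m.α₁ * m.σ ^ 2) * Real.exp (-(m.r * m.T))
  terminal : P m.T = m.v / (m.α₁ * m.σ ^ 2)

/-- The objective `𝔼 φ₁(X(T)) - θ D(Ṗ, dP̄₂/dt)`. For a decision which is `C¹` on `[0, T]` the
terminal wealth is Gaussian, so the expectation is that of an integrable variable. -/
def Model.objective (m : Model) (μ : Measure Ω) (θ : ℝ) (P : ℝ → ℝ) (X : ℝ → Ω → ℝ) : ℝ :=
  (∫ ω, utility m.α₁ (X m.T ω) ∂μ) - θ * m.disparity (m.rate P) (m.rate (m.rational m.α₂))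

/-- `P` is an optimal decision of the retail investor with imitation coefficient `θ`: it attains
the supremum of the objective over all feasible decisions and their wealth processes. -/
def Model.IsOptimal (m : Model) (W : ℝ≥0 → Ω → ℝ) (μ : Measure Ω) (θ : ℝ) (P : ℝ → ℝ) : Prop :=
  m.Feasible P ∧ ∃ X : ℝ → Ω → ℝ, m.IsWealth W μ P X ∧
    ∀ (Q : ℝ → ℝ) (Y : ℝ → Ω → ℝ), m.Feasible Q → m.IsWealth W μ Q Y →
      m.objective μ θ Q Y ≤ m.objective μ θ P X

/-- `Pinf` is the asymptotic decision: an optimal decision exists for every `θ > 0`, and optimal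
decisions, however chosen, converge to `Pinf` at every time of `[0, T]` as `θ → ∞`. -/
structure Model.IsAsymptotic (m : Model) (W : ℝ≥0 → Ω → ℝ) (μ : Measure Ω)
    (Pinf : ℝ → ℝ) : Prop where
  exists_optimal : ∀ θ : ℝ, 0 < θ → ∃ P : ℝ → ℝ, m.IsOptimal W μ θ P
  tendsto : ∀ Pstar : ℝ → ℝ → ℝ, (∀ θ : ℝ, 0 < θ → m.IsOptimal W μ θ (Pstar θ)) →
    ∀ t ∈ Icc 0 m.T, Tendsto (fun θ => Pstar θ t) atTop (𝓝 (Pinf t))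

end Wealth

end DecisionImitation

end

/-! Write a feasible decision as `rational α₁` plus a deviation `f` vanishing at both ends. Along a
Brownian path the wealth equation is linear, so variation of constants makes the terminal wealth
affine in the Wiener integral of `e^{-rt} P(t)`, which is Gaussian, and the expected utility is
explicit. Terms linear in `f` cancel because the rational decision is critical for the exponent;
what remains is `-C exp(K ∫ w f²)`. In the disparity, the difference of rates is `f' - f₀'` plus a
constant, where `f₀` is `imitation`, and the constant is orthogonal to `f' - f₀'` by the boundary
values. Hence (`Model.objective_eq`) the problem is to minimize `C exp(K ∫ w f²) + θ/2 ∫ (f' -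
f₀')²`.

Existence: the Euler-Lagrange equation is `f'' - f₀'' = s w f` with `θ s = 2 C K exp(K ∫ w f²)`, so
the coefficient `s` depends on `f` nonlocally. For frozen `s ≥ 0` it is the linear equation `(1 +
sA) f = f₀`, where `A` is `greenOp`. Monotonicity of `A` makes it solvable, with a weighted norm not
exceeding that of `f₀`; the intermediate value theorem then selects a consistent `s`, and convexity
turns the stationary point into a minimizer (`exists_isMin_penalizedCost`).

Limit: the competitor `f₀` pays no penalty, so an optimal `f` satisfies `|f - f₀| = O(θ^{-1/2})`
uniformly (`sq_sub_le_of_penalizedCost_le`), and the limit decision is `rational α₁ + f₀`. Since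
`f₀` is `gap` times (chord minus exponential), convexity of `exp` gives it the sign of `gap`, which
is that of `α₂ - α₁`; all the inequalities follow. -/

noncomputable section

namespace DecisionImitation

/-! ### Green's operator of the Dirichlet problem on `[0, T]`. -/

/-- The solution `g` of `g'' = -u`, `g(0) = g(T) = 0`. -/
def greenFun (T : ℝ) (u : ℝ → ℝ) (t : ℝ) : ℝ :=
  t / T * (∫ τ in (0 : ℝ)..T, ∫ s in (0 : ℝ)..τ, u s) - ∫ τ in (0 : ℝ)..t, ∫ s in (0 : ℝ)..τ, u s

/-- The derivative of `greenFun T u`. -/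
def greenSlope (T : ℝ) (u : ℝ → ℝ) (t : ℝ) : ℝ :=
  1 / T * (∫ τ in (0 : ℝ)..T, ∫ s in (0 : ℝ)..τ, u s) - ∫ s in (0 : ℝ)..t, u s

theorem hasDerivAt_primitive {u : ℝ → ℝ} (hu : Continuous u) (t : ℝ) :
    HasDerivAt (fun t => ∫ s in (0 : ℝ)..t, u s) (u t) t :=
  intervalIntegral.integral_hasDerivAt_right (hu.intervalIntegrable _ _)
    (hu.stronglyMeasurableAtFilter _ _) hu.continuousAt

theorem continuous_of_hasDerivAt {f f' : ℝ → ℝ} (h : ∀ t, HasDerivAt f (f' t) t) : Continuous f :=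
  continuous_iff_continuousAt.2 fun t => (h t).continuousAt

theorem continuous_primitive_zero {u : ℝ → ℝ} (hu : Continuous u) :
    Continuous fun t => ∫ s in (0 : ℝ)..t, u s :=
  continuous_of_hasDerivAt (hasDerivAt_primitive hu)

theorem hasDerivAt_greenFun {T : ℝ} {u : ℝ → ℝ} (hu : Continuous u) (t : ℝ) :
    HasDerivAt (greenFun T u) (greenSlope T u t) t := by
  unfold greenFun greenSlope
  exact (((hasDerivAt_id t).div_const T).mul_const _).sub
    (hasDerivAt_primitive (continuous_primitive_zero hu) t)

theorem hasDerivAt_greenSlope {T : ℝ} {u : ℝ → ℝ} (hu : Continuous u) (t : ℝ) :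
    HasDerivAt (greenSlope T u) (-u t) t := by
  unfold greenSlope
  exact (hasDerivAt_primitive hu t).const_sub _

theorem continuous_greenSlope {T : ℝ} {u : ℝ → ℝ} (hu : Continuous u) :
    Continuous (greenSlope T u) :=
  continuous_of_hasDerivAt (hasDerivAt_greenSlope hu)

theorem continuous_greenFun {T : ℝ} {u : ℝ → ℝ} (hu : Continuous u) : Continuous (greenFun T u) :=
  continuous_of_hasDerivAt (hasDerivAt_greenFun hu)

@[simp] theorem greenFun_zero {T : ℝ} {u : ℝ → ℝ} : greenFun T u 0 = 0 := by simp [greenFun]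

theorem greenFun_end {T : ℝ} (hT : 0 < T) {u : ℝ → ℝ} : greenFun T u T = 0 := by
  simp [greenFun, hT.ne']

theorem greenFun_add {T : ℝ} {u v : ℝ → ℝ} (hu : Continuous u) (hv : Continuous v) (t : ℝ) :
    greenFun T (fun s => u s + v s) t = greenFun T u t + greenFun T v t := by
  have h1 : ∀ τ, ∫ s in (0 : ℝ)..τ, (u s + v s) = (∫ s in (0 : ℝ)..τ, u s) + ∫ s in (0 : ℝ)..τ, v s :=
    fun τ => intervalIntegral.integral_add (hu.intervalIntegrable _ _) (hv.intervalIntegrable _ _)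
  have h2 : ∀ t, ∫ τ in (0 : ℝ)..t, ((∫ s in (0 : ℝ)..τ, u s) + ∫ s in (0 : ℝ)..τ, v s) =
      (∫ τ in (0 : ℝ)..t, ∫ s in (0 : ℝ)..τ, u s) + ∫ τ in (0 : ℝ)..t, ∫ s in (0 : ℝ)..τ, v s :=
    fun t => intervalIntegral.integral_add ((continuous_primitive_zero hu).intervalIntegrable _ _)
      ((continuous_primitive_zero hv).intervalIntegrable _ _)
  simp only [greenFun, h1, h2]
  ring

theorem greenFun_const_mul {T : ℝ} (c : ℝ) (u : ℝ → ℝ) (t : ℝ) :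
    greenFun T (fun s => c * u s) t = c * greenFun T u t := by
  simp only [greenFun, intervalIntegral.integral_const_mul]
  ring

/-- The source enters only through its L¹ norm, which is how an integral estimate becomes a sup-norm
estimate in `norm_le_norm_add_smul_greenOp`. -/
theorem abs_greenFun_le {T B : ℝ} (hT : 0 < T) {u : ℝ → ℝ} (hu : Continuous u)
    (hB : ∫ s in (0 : ℝ)..T, |u s| ≤ B) {t : ℝ} (ht : t ∈ Icc 0 T) :
    |greenFun T u t| ≤ 2 * T * B := by
  have h1 : ∀ τ ∈ Icc (0 : ℝ) T, |∫ s in (0 : ℝ)..τ, u s| ≤ B := fun τ hτ =>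
    (intervalIntegral.abs_integral_le_integral_abs hτ.1).trans
      ((intervalIntegral.integral_mono_interval le_rfl hτ.1 hτ.2
        (Eventually.of_forall fun _ => abs_nonneg _) (hu.abs.intervalIntegrable _ _)).trans hB)
  have hB0 : 0 ≤ B := (abs_nonneg _).trans (h1 0 ⟨le_rfl, hT.le⟩)
  have h2 : ∀ t ∈ Icc (0 : ℝ) T, |∫ τ in (0 : ℝ)..t, ∫ s in (0 : ℝ)..τ, u s| ≤ B * T := by
    intro t ht
    have := intervalIntegral.norm_integral_le_of_norm_le_const (a := (0 : ℝ)) (b := t) (C := B)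
      (f := fun τ => ∫ s in (0 : ℝ)..τ, u s) (fun x hx => by
        rw [uIoc_of_le ht.1] at hx
        exact h1 x ⟨hx.1.le, hx.2.trans ht.2⟩)
    rw [Real.norm_eq_abs, sub_zero, abs_of_nonneg ht.1] at this
    exact this.trans (mul_le_mul_of_nonneg_left ht.2 hB0)
  have h3 := h2 T ⟨hT.le, le_rfl⟩
  have h4 := h2 t ht
  have h5 : |t / T| ≤ 1 := by
    rw [abs_of_nonneg (div_nonneg ht.1 hT.le), div_le_one hT]
    exact ht.2
  unfold greenFun
  calc |t / T * (∫ τ in (0 : ℝ)..T, ∫ s in (0 : ℝ)..τ, u s) -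
        ∫ τ in (0 : ℝ)..t, ∫ s in (0 : ℝ)..τ, u s| ≤
        |t / T| * |∫ τ in (0 : ℝ)..T, ∫ s in (0 : ℝ)..τ, u s| +
        |∫ τ in (0 : ℝ)..t, ∫ s in (0 : ℝ)..τ, u s| := by
        rw [← abs_mul]; exact abs_sub _ _
    _ ≤ 1 * (B * T) + B * T := by gcongr
    _ = 2 * T * B := by ring

/-- Green's identity for functions vanishing at both end points. -/
theorem integral_mul_eq_integral_greenSlope_mul {T : ℝ} {u h h' : ℝ → ℝ} (hu : Continuous u)
    (hh : ∀ t, HasDerivAt h (h' t) t) (hh' : Continuous h') (h0 : h 0 = 0) (hT : h T = 0) :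
    ∫ t in (0 : ℝ)..T, u t * h t = ∫ t in (0 : ℝ)..T, greenSlope T u t * h' t := by
  have := intervalIntegral.integral_mul_deriv_eq_deriv_mul (a := 0) (b := T)
    (fun x _ => hasDerivAt_greenSlope (T := T) hu x) (fun x _ => hh x)
    (hu.neg.intervalIntegrable _ _) (hh'.intervalIntegrable _ _)
  rw [this, h0, hT]
  simp

theorem integral_mul_greenFun_nonneg {T : ℝ} (hT : 0 < T) {u : ℝ → ℝ} (hu : Continuous u) :
    0 ≤ ∫ t in (0 : ℝ)..T, u t * greenFun T u t := by
  rw [integral_mul_eq_integral_greenSlope_mul hu (hasDerivAt_greenFun hu)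
    (continuous_greenSlope hu) greenFun_zero (greenFun_end hT)]
  exact intervalIntegral.integral_nonneg hT.le fun t _ => mul_self_nonneg _

/-! ### Solvability of the linear equation `f + s A f = p`. -/

/-- If `1 + sA` is bounded below uniformly for `s ∈ [0, S]`, then it is invertible for all these
`s` (the method of continuity). -/
theorem isUnit_one_add_smul {E : Type*} [NormedAddCommGroup E] [NormedSpace ℝ E] [CompleteSpace E]
    [Nontrivial E] (A : E →L[ℝ] E) {S M : ℝ} (hM : 0 < M)
    (h : ∀ s ∈ Icc 0 S, ∀ f : E, ‖f‖ ≤ M * ‖f + s • A f‖) {s : ℝ} (hs : s ∈ Icc 0 S) :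
    IsUnit (1 + s • A : E →L[ℝ] E) := by
  -- Inverses met along the way have norm at most `M`, so perturbations of norm below `M⁻¹` preserve
  -- invertibility. A step `ε` changes the operator by at most `ε ‖A‖ < M⁻¹`; the `+ 1` also covers
  -- `A = 0`.
  set ε : ℝ := M⁻¹ / (‖A‖ + 1) with hε
  have hA : 0 < ‖A‖ + 1 := by positivity
  have hε0 : 0 < ε := by positivity
  have key : ∀ n : ℕ, ∀ s ∈ Icc 0 S, s ≤ n * ε → IsUnit (1 + s • A : E →L[ℝ] E) := by
    intro n
    induction n with
    | zero =>
      intro s hs hs'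
      have : s = 0 := le_antisymm (by simpa using hs') hs.1
      simp [this]
    | succ n ih =>
      intro s hs hs'
      set t : ℝ := max 0 (s - ε) with ht
      have ht1 : t ∈ Icc 0 S := ⟨le_max_left _ _, max_le (hs.1.trans hs.2) (by linarith [hs.2])⟩
      have ht2 : t ≤ n * ε := by
        refine max_le (by positivity) ?_
        push_cast at hs'
        linarith
      obtain ⟨x, hx⟩ := ih t ht1 ht2
      have hinv : ‖((x⁻¹ : (E →L[ℝ] E)ˣ) : E →L[ℝ] E)‖ ≤ M := by
        refine ContinuousLinearMap.opNorm_le_bound _ hM.le fun y => ?_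
        have h1 := h t ht1 ((x⁻¹ : (E →L[ℝ] E)ˣ).1 y)
        have h2 : (x⁻¹ : (E →L[ℝ] E)ˣ).1 y + t • A ((x⁻¹ : (E →L[ℝ] E)ˣ).1 y) = y := by
          have h3 : (x.1 * (x⁻¹ : (E →L[ℝ] E)ˣ).1) y = y := by simp
          rw [hx] at h3
          simpa using h3
        rwa [h2] at h1
      have hts : |s - t| ≤ ε := by
        rcases max_cases 0 (s - ε) with h | h
        · rw [ht, h.1, sub_zero, abs_of_nonneg hs.1]; linarith [h.2]
        · rw [ht, h.1, sub_sub_cancel, abs_of_pos hε0]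
      refine (Units.ofNearby x (1 + s • A) ?_).isUnit
      have hpos : 0 < ‖((x⁻¹ : (E →L[ℝ] E)ˣ) : E →L[ℝ] E)‖ := Units.norm_pos _
      calc ‖(1 + s • A) - x.1‖ = ‖(s - t) • A‖ := by rw [hx]; congr 1; module
        _ = |s - t| * ‖A‖ := by rw [norm_smul, Real.norm_eq_abs]
        _ ≤ ε * ‖A‖ := by gcongr
        _ < ε * (‖A‖ + 1) := by linarith
        _ = M⁻¹ := by rw [hε]; field_simp
        _ ≤ _ := by gcongr
  obtain ⟨n, hn⟩ := exists_nat_ge (s / ε)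
  exact key n s hs ((div_le_iff₀ hε0).1 hn)

/-- A function on `[0, T]`, extended by constants and multiplied by the weight `w`. -/
def weighted {T : ℝ} (hT : 0 < T) (w : ℝ → ℝ) (f : C(Icc (0 : ℝ) T, ℝ)) (t : ℝ) : ℝ :=
  w t * IccExtend hT.le f t

theorem continuous_weighted {T : ℝ} (hT : 0 < T) {w : ℝ → ℝ} (hw : Continuous w)
    (f : C(Icc (0 : ℝ) T, ℝ)) : Continuous (weighted hT w f) :=
  hw.mul f.continuous.Icc_extend'

theorem abs_IccExtend_le {T : ℝ} (hT : 0 < T) (f : C(Icc (0 : ℝ) T, ℝ)) (t : ℝ) :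
    |IccExtend hT.le f t| ≤ ‖f‖ :=
  f.norm_coe_le_norm _

theorem integral_abs_weighted_le {T : ℝ} (hT : 0 < T) {w : ℝ → ℝ} (hw : Continuous w)
    (hw0 : ∀ t, 0 ≤ w t) (f : C(Icc (0 : ℝ) T, ℝ)) :
    ∫ t in (0 : ℝ)..T, |weighted hT w f t| ≤ (∫ t in (0 : ℝ)..T, w t) * ‖f‖ := by
  rw [← intervalIntegral.integral_mul_const]
  refine intervalIntegral.integral_mono_on hT.le
    ((continuous_weighted hT hw f).abs.intervalIntegrable _ _)
    ((hw.mul continuous_const).intervalIntegrable _ _) fun t _ => ?_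
  rw [weighted, abs_mul, abs_of_nonneg (hw0 t)]
  exact mul_le_mul_of_nonneg_left (abs_IccExtend_le hT f t) (hw0 t)

/-- The operator sending `f` to the solution `g` of `g'' = -w f`, `g(0) = g(T) = 0`. -/
def greenOp {T : ℝ} (hT : 0 < T) {w : ℝ → ℝ} (hw : Continuous w) (hw0 : ∀ t, 0 ≤ w t) :
    C(Icc (0 : ℝ) T, ℝ) →L[ℝ] C(Icc (0 : ℝ) T, ℝ) :=
  LinearMap.mkContinuous
    { toFun := fun f => ⟨fun t => greenFun T (weighted hT w f) t,
        (continuous_greenFun (continuous_weighted hT hw f)).comp continuous_subtype_val⟩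
      map_add' := fun f g => by
        ext t
        have : weighted hT w (f + g) = fun s => weighted hT w f s + weighted hT w g s := by
          ext s; simp only [weighted, IccExtend, Function.comp, ContinuousMap.add_apply]; ring
        simp [this, greenFun_add (continuous_weighted hT hw f) (continuous_weighted hT hw g)]
      map_smul' := fun c f => by
        ext t
        have : weighted hT w (c • f) = fun s => c * weighted hT w f s := by
          ext s
          simp only [weighted, IccExtend, Function.comp, ContinuousMap.smul_apply, smul_eq_mul]
          ring
        simp [this, greenFun_const_mul] }
    (2 * T * ∫ t in (0 : ℝ)..T, w t) fun f => by
      have h0 : 0 ≤ ∫ t in (0 : ℝ)..T, w t :=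
        intervalIntegral.integral_nonneg hT.le fun t _ => hw0 t
      refine (ContinuousMap.norm_le _ (by positivity)).2 fun t => ?_
      rw [mul_assoc (2 * T)]
      exact abs_greenFun_le hT (continuous_weighted hT hw f)
        (integral_abs_weighted_le hT hw hw0 f) t.2

theorem greenOp_apply {T : ℝ} (hT : 0 < T) {w : ℝ → ℝ} (hw : Continuous w) (hw0 : ∀ t, 0 ≤ w t)
    (f : C(Icc (0 : ℝ) T, ℝ)) (t : Icc (0 : ℝ) T) :
    greenOp hT hw hw0 f t = greenFun T (weighted hT w f) t := rfl

/-- On expanding the square, the cross term is `2s` times the pairing of the source `w F` with its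
own Green solution, which is nonnegative: the operator is monotone for the `w`-weighted inner
product. -/
theorem integral_weighted_sq_le {T : ℝ} (hT : 0 < T) {w F : ℝ → ℝ} (hw : Continuous w)
    (hw0 : ∀ t, 0 ≤ w t) (hF : Continuous F) {s : ℝ} (hs : 0 ≤ s) :
    ∫ t in (0 : ℝ)..T, w t * F t ^ 2 ≤
      ∫ t in (0 : ℝ)..T, w t * (F t + s * greenFun T (fun τ => w τ * F τ) t) ^ 2 := by
  have hg : Continuous (greenFun T fun τ => w τ * F τ) := continuous_greenFun (hw.mul hF)
  have h1 : ∫ t in (0 : ℝ)..T, (w t * F t ^ 2 +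
        2 * s * (w t * F t * greenFun T (fun τ => w τ * F τ) t)) ≤
      ∫ t in (0 : ℝ)..T, w t * (F t + s * greenFun T (fun τ => w τ * F τ) t) ^ 2 := by
    refine intervalIntegral.integral_mono_on hT.le
      (Continuous.intervalIntegrable (by fun_prop) _ _)
      (Continuous.intervalIntegrable (by fun_prop) _ _) fun t _ => ?_
    have := mul_nonneg (hw0 t) (sq_nonneg (s * greenFun T (fun τ => w τ * F τ) t))
    nlinarith
  rw [intervalIntegral.integral_add (Continuous.intervalIntegrable (by fun_prop) _ _)
    (Continuous.intervalIntegrable (by fun_prop) _ _), intervalIntegral.integral_const_mul] at h1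
  have h2 : 0 ≤ ∫ t in (0 : ℝ)..T, w t * F t * greenFun T (fun τ => w τ * F τ) t :=
    integral_mul_greenFun_nonneg hT (hw.mul hF)
  nlinarith [mul_nonneg hs h2]

/-- Monotonicity bounds `f` by `p = f + s A f` only in weighted L². That controls the weighted L¹
norm of `f`, hence the sup norm of `A f`, and finally that of `f = p - s A f`. -/
theorem norm_le_norm_add_smul_greenOp {T : ℝ} (hT : 0 < T) {w : ℝ → ℝ} (hw : Continuous w)
    (hw0 : ∀ t, 0 ≤ w t) {s : ℝ} (hs : 0 ≤ s) (f : C(Icc (0 : ℝ) T, ℝ)) :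
    ‖f‖ ≤ (1 + s * (2 * T * ∫ t in (0 : ℝ)..T, w t)) * ‖f + s • greenOp hT hw hw0 f‖ := by
  set I : ℝ := ∫ t in (0 : ℝ)..T, w t with hI
  have hI0 : 0 ≤ I := intervalIntegral.integral_nonneg hT.le fun t _ => hw0 t
  set p := f + s • greenOp hT hw hw0 f with hp
  have hFc : Continuous (IccExtend hT.le f) := f.continuous.Icc_extend'
  have hpt : ∀ t ∈ Icc (0 : ℝ) T,
      IccExtend hT.le f t + s * greenFun T (weighted hT w f) t = IccExtend hT.le p t := by
    intro t ht
    rw [IccExtend_of_mem _ _ ht, IccExtend_of_mem _ _ ht]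
    simp [hp, greenOp_apply]
  have hM : 0 < 1 + s * (2 * T * I) := by positivity
  rw [← div_le_iff₀' hM]
  -- Using `c > ‖p‖` in place of `‖p‖` keeps `c` positive, so that it can be divided by below.
  refine le_of_forall_gt_imp_ge_of_dense fun c hc => ?_
  have hc0 : 0 < c := (norm_nonneg _).trans_lt hc
  rw [div_le_iff₀' hM]
  have h1 : ∫ t in (0 : ℝ)..T, w t * IccExtend hT.le f t ^ 2 ≤ I * c ^ 2 := by
    refine (integral_weighted_sq_le hT hw hw0 hFc hs).trans ?_
    rw [hI, ← intervalIntegral.integral_mul_const]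
    have hg : Continuous (greenFun T fun τ => w τ * IccExtend hT.le f τ) :=
      continuous_greenFun (hw.mul hFc)
    refine intervalIntegral.integral_mono_on hT.le
      (Continuous.intervalIntegrable (by fun_prop) _ _)
      (Continuous.intervalIntegrable (by fun_prop) _ _) fun t ht => ?_
    have h2 := hpt t ht
    unfold weighted at h2
    rw [h2]
    refine mul_le_mul_of_nonneg_left ?_ (hw0 t)
    rw [← sq_abs (IccExtend hT.le p t)]
    gcongr
    exact (abs_IccExtend_le hT p t).trans hc.le
  have h2 : ∫ t in (0 : ℝ)..T, |weighted hT w f t| ≤ I * c := by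
    -- Young's inequality `|f| ≤ c/2 + f²/(2c)` replaces Cauchy-Schwarz.
    have h3 : ∫ t in (0 : ℝ)..T, |weighted hT w f t| ≤
        ∫ t in (0 : ℝ)..T, (w t * (c / 2) + w t * IccExtend hT.le f t ^ 2 * (1 / (2 * c))) := by
      refine intervalIntegral.integral_mono_on hT.le
        ((continuous_weighted hT hw f).abs.intervalIntegrable _ _)
        (Continuous.intervalIntegrable (by fun_prop) _ _) fun t _ => ?_
      rw [weighted, abs_mul, abs_of_nonneg (hw0 t), mul_assoc, ← mul_add]
      refine mul_le_mul_of_nonneg_left ?_ (hw0 t)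
      rw [← sq_abs (IccExtend hT.le f t)]
      have : |IccExtend hT.le f t| * (2 * c) ≤ c ^ 2 + |IccExtend hT.le f t| ^ 2 := by
        nlinarith [sq_nonneg (|IccExtend hT.le f t| - c)]
      calc |IccExtend hT.le f t| ≤ (c ^ 2 + |IccExtend hT.le f t| ^ 2) / (2 * c) := by
            rwa [le_div_iff₀ (by positivity)]
        _ = _ := by field_simp
    rw [intervalIntegral.integral_add (Continuous.intervalIntegrable (by fun_prop) _ _)
      (Continuous.intervalIntegrable (by fun_prop) _ _), intervalIntegral.integral_mul_const,
      intervalIntegral.integral_mul_const, ← hI] at h3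
    refine h3.trans ?_
    calc I * (c / 2) + (∫ t in (0 : ℝ)..T, w t * IccExtend hT.le f t ^ 2) * (1 / (2 * c)) ≤
          I * (c / 2) + I * c ^ 2 * (1 / (2 * c)) := by gcongr
      _ = I * c := by field_simp; ring
  refine (ContinuousMap.norm_le _ (by positivity)).2 fun t => ?_
  have h4 := hpt t t.2
  rw [IccExtend_of_mem _ _ t.2] at h4
  have h5 := abs_IccExtend_le hT p t
  have h6 := abs_greenFun_le hT (continuous_weighted hT hw f) h2 t.2
  rw [Real.norm_eq_abs]
  have h7 : f t = IccExtend hT.le p t - s * greenFun T (weighted hT w f) t := by linarith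
  calc |f t| ≤ |IccExtend hT.le p t| + |s * greenFun T (weighted hT w f) t| := by
        rw [h7]; exact abs_sub _ _
    _ ≤ c + s * (2 * T * (I * c)) := by
        rw [abs_mul, abs_of_nonneg hs]
        gcongr
        exact h5.trans hc.le
    _ = (1 + s * (2 * T * I)) * c := by ring

theorem isUnit_one_add_smul_greenOp {T : ℝ} (hT : 0 < T) {w : ℝ → ℝ} (hw : Continuous w)
    (hw0 : ∀ t, 0 ≤ w t) {s : ℝ} (hs : 0 ≤ s) :
    IsUnit (1 + s • greenOp hT hw hw0 : C(Icc (0 : ℝ) T, ℝ) →L[ℝ] C(Icc (0 : ℝ) T, ℝ)) := by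
  have hI0 : 0 ≤ ∫ t in (0 : ℝ)..T, w t :=
    intervalIntegral.integral_nonneg hT.le fun t _ => hw0 t
  -- This makes the function space nontrivial, as `isUnit_one_add_smul` requires.
  have : Nonempty (Icc (0 : ℝ) T) := ⟨⟨0, le_rfl, hT.le⟩⟩
  refine isUnit_one_add_smul (greenOp hT hw hw0) (S := s)
    (M := 1 + s * (2 * T * ∫ t in (0 : ℝ)..T, w t)) (by positivity) (fun r hr f => ?_) ⟨hs, le_rfl⟩
  refine (norm_le_norm_add_smul_greenOp hT hw hw0 hr.1 f).trans ?_
  have := hr.2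
  gcongr

/-! ### The penalized variational problem: minimizers and large `θ`. -/

/-- The penalized cost of a deviation `f` with derivative `f'`. -/
def penalizedCost (T : ℝ) (w f₀' : ℝ → ℝ) (C K θ : ℝ) (f f' : ℝ → ℝ) : ℝ :=
  C * Real.exp (K * ∫ t in (0 : ℝ)..T, w t * f t ^ 2) +
    θ / 2 * ∫ t in (0 : ℝ)..T, (f' t - f₀' t) ^ 2

/-- A solution of the Euler-Lagrange equation minimizes the penalized cost. -/
theorem penalizedCost_le_of_stationary {T : ℝ} (hT : 0 < T) {w f₀' : ℝ → ℝ} (hw : Continuous w)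
    (hw0 : ∀ t, 0 ≤ w t) (hf₀' : Continuous f₀') {C K θ s : ℝ} (hC : 0 < C) (hK : 0 < K)
    (hθ : 0 < θ) {f f' : ℝ → ℝ}
    (hf : ∀ t, HasDerivAt f (f' t) t) (hf' : Continuous f') (hf0 : f 0 = 0) (hfT : f T = 0)
    {u : ℝ → ℝ} (hu : Continuous u) (huf : ∀ t ∈ Icc (0 : ℝ) T, u t = w t * f t)
    (hslope : ∀ t, f' t - f₀' t = -(s * greenSlope T u t))
    (hs : θ * s = 2 * C * K * Real.exp (K * ∫ t in (0 : ℝ)..T, w t * f t ^ 2))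
    {q q' : ℝ → ℝ} (hq : ∀ t, HasDerivAt q (q' t) t) (hq' : Continuous q') (hq0 : q 0 = 0)
    (hqT : q T = 0) :
    penalizedCost T w f₀' C K θ f f' ≤ penalizedCost T w f₀' C K θ q q' := by
  have hfc : Continuous f := continuous_of_hasDerivAt hf
  have hqc : Continuous q := continuous_of_hasDerivAt hq
  have hsc : Continuous (greenSlope T u) := continuous_greenSlope hu
  set E := Real.exp (K * ∫ t in (0 : ℝ)..T, w t * f t ^ 2) with hE
  have hE0 : 0 < E := Real.exp_pos _
  set B := ∫ t in (0 : ℝ)..T, u t * (q t - f t) with hB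
  have hgreen : B = ∫ t in (0 : ℝ)..T, greenSlope T u t * (q' t - f' t) :=
    integral_mul_eq_integral_greenSlope_mul hu (fun t => (hq t).sub (hf t)) (hq'.sub hf')
      (by simp [hf0, hq0]) (by simp [hfT, hqT])
  have h1 : (∫ t in (0 : ℝ)..T, w t * f t ^ 2) + 2 * B ≤ ∫ t in (0 : ℝ)..T, w t * q t ^ 2 := by
    rw [hB, ← intervalIntegral.integral_const_mul, ← intervalIntegral.integral_add
      (Continuous.intervalIntegrable (by fun_prop) _ _)
      (Continuous.intervalIntegrable (by fun_prop) _ _)]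
    refine intervalIntegral.integral_mono_on hT.le
      (Continuous.intervalIntegrable (by fun_prop) _ _)
      (Continuous.intervalIntegrable (by fun_prop) _ _) fun t ht => ?_
    rw [huf t ht]
    nlinarith [mul_nonneg (hw0 t) (sq_nonneg (q t - f t))]
  have h2 : (∫ t in (0 : ℝ)..T, (f' t - f₀' t) ^ 2) - 2 * s * B ≤
      ∫ t in (0 : ℝ)..T, (q' t - f₀' t) ^ 2 := by
    rw [hgreen, ← intervalIntegral.integral_const_mul, ← intervalIntegral.integral_sub
      (Continuous.intervalIntegrable (by fun_prop) _ _)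
      (Continuous.intervalIntegrable (by fun_prop) _ _)]
    refine intervalIntegral.integral_mono_on hT.le
      (Continuous.intervalIntegrable (by fun_prop) _ _)
      (Continuous.intervalIntegrable (by fun_prop) _ _) fun t _ => ?_
    have h3 : q' t - f₀' t = (q' t - f' t) + -(s * greenSlope T u t) := by rw [← hslope t]; ring
    rw [h3, hslope t]
    nlinarith [sq_nonneg (q' t - f' t)]
  -- Tangent line inequality for `exp` at the exponent belonging to `f`.
  have h3 : E * (1 + 2 * K * B) ≤ Real.exp (K * ∫ t in (0 : ℝ)..T, w t * q t ^ 2) := by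
    have h4 : K * (∫ t in (0 : ℝ)..T, w t * f t ^ 2) + 2 * K * B ≤
        K * ∫ t in (0 : ℝ)..T, w t * q t ^ 2 := by nlinarith
    refine le_trans ?_ (Real.exp_le_exp.2 h4)
    rw [Real.exp_add]
    have := Real.add_one_le_exp (2 * K * B)
    gcongr
    linarith
  unfold penalizedCost
  rw [← hE]
  have h4 := mul_le_mul_of_nonneg_left h3 hC.le
  have h5 := mul_le_mul_of_nonneg_left h2 (half_pos hθ).le
  -- The relation `hs` for the multiplier is exactly what makes the first-order terms of the two
  -- parts of the cost cancel.
  have h6 : θ / 2 * (2 * s * B) = C * E * (2 * K * B) := by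
    calc θ / 2 * (2 * s * B) = θ * s * B := by ring
      _ = _ := by rw [hs]; ring
  nlinarith

theorem exists_isMin_penalizedCost {T : ℝ} (hT : 0 < T) {w f₀ f₀' : ℝ → ℝ} (hw : Continuous w)
    (hw0 : ∀ t, 0 ≤ w t) (hf₀ : ∀ t, HasDerivAt f₀ (f₀' t) t) (hf₀' : Continuous f₀')
    (h00 : f₀ 0 = 0) (h0T : f₀ T = 0) {C K θ : ℝ} (hC : 0 < C) (hK : 0 < K) (hθ : 0 < θ) :
    ∃ f f' : ℝ → ℝ, (∀ t, HasDerivAt f (f' t) t) ∧ Continuous f' ∧ f 0 = 0 ∧ f T = 0 ∧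
      ∀ q q' : ℝ → ℝ, (∀ t, HasDerivAt q (q' t) t) → Continuous q' → q 0 = 0 → q T = 0 →
        penalizedCost T w f₀' C K θ f f' ≤ penalizedCost T w f₀' C K θ q q' := by
  have hf₀c : Continuous f₀ := continuous_of_hasDerivAt hf₀
  set A := greenOp hT hw hw0 with hA
  set g₀ : C(Icc (0 : ℝ) T, ℝ) := ⟨fun t => f₀ t, hf₀c.comp continuous_subtype_val⟩ with hg₀
  set R : ℝ → C(Icc (0 : ℝ) T, ℝ) := fun s => Ring.inverse (1 + s • A) g₀ with hR
  set Q : C(Icc (0 : ℝ) T, ℝ) → ℝ := fun f => ∫ t in (0 : ℝ)..T, w t * IccExtend hT.le f t ^ 2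
    with hQ
  have hQc : Continuous Q := by
    refine intervalIntegral.continuous_parametric_intervalIntegral_of_continuous' ?_ 0 T
    simp only [IccExtend, Function.comp_def]
    have hproj : Continuous (projIcc (0 : ℝ) T hT.le) := continuous_projIcc
    fun_prop
  have hunit : ∀ s : ℝ, 0 ≤ s → IsUnit (1 + s • A) := fun s hs =>
    isUnit_one_add_smul_greenOp hT hw hw0 hs
  have hRc : ContinuousOn R (Ici 0) := by
    intro s hs
    obtain ⟨x, hx⟩ := hunit s hs
    have h1 := NormedRing.inverse_continuousAt
      (R := C(Icc (0 : ℝ) T, ℝ) →L[ℝ] C(Icc (0 : ℝ) T, ℝ)) x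
    rw [hx] at h1
    have h2 : ContinuousAt (fun s : ℝ => 1 + s • A) s := by fun_prop
    have h3 : ContinuousAt (fun s : ℝ => Ring.inverse (1 + s • A)) s :=
      ContinuousAt.comp (f := fun s : ℝ => 1 + s • A) h1 h2
    exact (h3.clm_apply continuousAt_const).continuousWithinAt
  have hRs : ∀ s : ℝ, 0 ≤ s → R s + s • A (R s) = g₀ := by
    intro s hs
    have h1 : (1 + s • A) * Ring.inverse (1 + s • A) = 1 := Ring.mul_inverse_cancel _ (hunit s hs)
    simpa using congrArg (fun L => L g₀) h1
  have hpt : ∀ s : ℝ, 0 ≤ s → ∀ t ∈ Icc (0 : ℝ) T, IccExtend hT.le (R s) t +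
      s * greenFun T (weighted hT w (R s)) t = f₀ t := by
    intro s hs t ht
    have h1 := congrArg (fun f : C(Icc (0 : ℝ) T, ℝ) => f ⟨t, ht⟩) (hRs s hs)
    rw [IccExtend_of_mem _ _ ht]
    simpa [hA, greenOp_apply, hg₀] using h1
  set B := ∫ t in (0 : ℝ)..T, w t * f₀ t ^ 2 with hB
  have hQR : ∀ s : ℝ, 0 ≤ s → Q (R s) ≤ B := by
    intro s hs
    refine (integral_weighted_sq_le hT hw hw0 (R s).continuous.Icc_extend' hs).trans (le_of_eq ?_)
    refine intervalIntegral.integral_congr fun t ht => ?_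
    rw [uIcc_of_le hT.le] at ht
    have := hpt s hs t ht
    unfold weighted at this
    simp only [this]
  -- The multiplier must be consistent with the solution `R s` it produces. The expression is
  -- negative at `0`, and nonnegative at `S` because `Q (R S) ≤ B`.
  obtain ⟨s, hs0, hs⟩ : ∃ s : ℝ, 0 ≤ s ∧ θ * s - 2 * C * K * Real.exp (K * Q (R s)) = 0 := by
    set S := 2 * C * K * Real.exp (K * B) / θ with hS
    have hS0 : 0 ≤ S := by positivity
    have hc : ContinuousOn (fun s => θ * s - 2 * C * K * Real.exp (K * Q (R s))) (Icc 0 S) := by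
      have : ContinuousOn (fun s => Q (R s)) (Icc 0 S) :=
        hQc.comp_continuousOn (hRc.mono Icc_subset_Ici_self)
      exact (continuousOn_const.mul continuousOn_id).sub
        (continuousOn_const.mul (Real.continuous_exp.comp_continuousOn (continuousOn_const.mul this)))
    obtain ⟨s, hs, hs'⟩ := intermediate_value_Icc hS0 hc (show (0 : ℝ) ∈ _ from by
      constructor
      · have : 0 < 2 * C * K * Real.exp (K * Q (R 0)) := by positivity
        linarith
      · have h1 : θ * S = 2 * C * K * Real.exp (K * B) := by rw [hS]; field_simp
        have h2 := hQR S hS0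
        have h3 : 2 * C * K * Real.exp (K * Q (R S)) ≤ 2 * C * K * Real.exp (K * B) := by gcongr
        linarith)
    exact ⟨s, hs.1, hs'⟩
  set u := weighted hT w (R s) with hu
  have huc : Continuous u := continuous_weighted hT hw _
  have hfR : ∀ t ∈ Icc (0 : ℝ) T, IccExtend hT.le (R s) t = f₀ t - s * greenFun T u t :=
    fun t ht => by linarith [hpt s hs0 t ht]
  have hQs : Q (R s) = ∫ t in (0 : ℝ)..T, w t * (f₀ t - s * greenFun T u t) ^ 2 := by
    refine intervalIntegral.integral_congr fun t ht => ?_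
    rw [uIcc_of_le hT.le] at ht
    simp only [hfR t ht]
  refine ⟨fun t => f₀ t - s * greenFun T u t, fun t => f₀' t - s * greenSlope T u t,
    fun t => (hf₀ t).sub ((hasDerivAt_greenFun huc t).const_mul s),
    hf₀'.sub (continuous_const.mul (continuous_greenSlope huc)), by simp [h00],
    by simp [h0T, greenFun_end hT], fun q q' hq hq' hq0 hqT => ?_⟩
  refine penalizedCost_le_of_stationary hT hw hw0 hf₀' hC hK hθ
    (f := fun t => f₀ t - s * greenFun T u t) (f' := fun t => f₀' t - s * greenSlope T u t)
    (fun t => (hf₀ t).sub ((hasDerivAt_greenFun huc t).const_mul s))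
    (hf₀'.sub (continuous_const.mul (continuous_greenSlope huc))) (by simp [h00])
    (by simp [h0T, greenFun_end hT]) huc (s := s) (fun t ht => ?_) (fun t => by ring) ?_
    hq hq' hq0 hqT
  · rw [← hfR t ht, hu, weighted]
  · rw [← hQs]; linarith

/-- Poincaré type inequality: a primitive vanishing at `0` is controlled by its derivative. -/
theorem sq_le_mul_integral_sq {T : ℝ} {d d' : ℝ → ℝ} (hd : ∀ t, HasDerivAt d (d' t) t)
    (hd' : Continuous d') (hd0 : d 0 = 0) {t : ℝ} (ht : t ∈ Icc 0 T) :
    d t ^ 2 ≤ T * ∫ s in (0 : ℝ)..T, d' s ^ 2 := by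
  have h1 : ∫ s in (0 : ℝ)..t, d' s = d t := by
    rw [intervalIntegral.integral_eq_sub_of_hasDerivAt (fun x _ => hd x)
      (hd'.intervalIntegrable _ _), hd0, sub_zero]
  have h2 : ∫ s in (0 : ℝ)..t, d' s ^ 2 ≤ ∫ s in (0 : ℝ)..T, d' s ^ 2 :=
    intervalIntegral.integral_mono_interval le_rfl ht.1 ht.2
      (Eventually.of_forall fun _ => sq_nonneg _) ((hd'.pow 2).intervalIntegrable _ _)
  have h0 : 0 ≤ ∫ s in (0 : ℝ)..t, d' s ^ 2 :=
    intervalIntegral.integral_nonneg ht.1 fun _ _ => sq_nonneg _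
  refine le_trans ?_ (mul_le_mul ht.2 h2 h0 (ht.1.trans ht.2))
  rcases ht.1.eq_or_lt with rfl | htpos
  · simp [hd0]
  -- Cauchy-Schwarz as nonnegativity of a variance: `d t / t` is the mean of `d'` on `[0, t]`.
  have h3 : 0 ≤ ∫ s in (0 : ℝ)..t, (d' s - d t / t) ^ 2 :=
    intervalIntegral.integral_nonneg ht.1 fun _ _ => sq_nonneg _
  have h4 : ∫ s in (0 : ℝ)..t, (d' s - d t / t) ^ 2 =
      (∫ s in (0 : ℝ)..t, d' s ^ 2) - 2 * (d t / t) * d t + t * (d t / t) ^ 2 := by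
    have : ∀ s, (d' s - d t / t) ^ 2 = d' s ^ 2 - 2 * (d t / t) * d' s + (d t / t) ^ 2 :=
      fun s => by ring
    simp only [this]
    rw [intervalIntegral.integral_add (Continuous.intervalIntegrable (by fun_prop) _ _)
      (Continuous.intervalIntegrable (by fun_prop) _ _), intervalIntegral.integral_sub
      (Continuous.intervalIntegrable (by fun_prop) _ _)
      (Continuous.intervalIntegrable (by fun_prop) _ _), intervalIntegral.integral_const_mul, h1]
    simp
  rw [h4] at h3
  have h5 : t * ((∫ s in (0 : ℝ)..t, d' s ^ 2) - 2 * (d t / t) * d t + t * (d t / t) ^ 2) =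
      t * (∫ s in (0 : ℝ)..t, d' s ^ 2) - d t ^ 2 := by field_simp; ring
  nlinarith [mul_nonneg htpos.le h3]

/-- A deviation which is not more costly than `f₀` is close to `f₀` when `θ` is large. -/
theorem sq_sub_le_of_penalizedCost_le {T : ℝ} (hT : 0 < T) {w f₀ f₀' f f' : ℝ → ℝ}
    (hf₀ : ∀ t, HasDerivAt f₀ (f₀' t) t) (hf₀' : Continuous f₀')
    (h00 : f₀ 0 = 0) (hf : ∀ t, HasDerivAt f (f' t) t) (hf' : Continuous f') (hf0 : f 0 = 0)
    {C K θ : ℝ} (hC : 0 < C) (hθ : 0 < θ)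
    (hle : penalizedCost T w f₀' C K θ f f' ≤ penalizedCost T w f₀' C K θ f₀ f₀')
    {t : ℝ} (ht : t ∈ Icc 0 T) :
    (f t - f₀ t) ^ 2 ≤
      2 * T * C * Real.exp (K * ∫ t in (0 : ℝ)..T, w t * f₀ t ^ 2) / θ := by
  have h1 := sq_le_mul_integral_sq (fun t => (hf t).sub (hf₀ t)) (hf'.sub hf₀')
    (by simp [hf0, h00]) ht
  refine h1.trans ?_
  unfold penalizedCost at hle
  simp only [sub_self, ne_eq, OfNat.ofNat_ne_zero, not_false_eq_true, zero_pow,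
    intervalIntegral.integral_zero, mul_zero, add_zero] at hle
  have h2 : 0 < C * Real.exp (K * ∫ t in (0 : ℝ)..T, w t * f t ^ 2) := by positivity
  rw [le_div_iff₀ hθ]
  nlinarith

/-! ### Riemann-Stieltjes sums and integrals along a continuous path. -/

theorem grid_mem {t : ℝ} (ht : 0 ≤ t) {n k : ℕ} (hk : k ≤ n) : t * (k : ℝ) / n ∈ Icc 0 t := by
  refine ⟨by positivity, ?_⟩
  rcases Nat.eq_zero_or_pos n with rfl | hn
  · simpa using ht
  · have : (0 : ℝ) < n := by exact_mod_cast hn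
    rw [div_le_iff₀ this]
    have : (k : ℝ) ≤ n := by exact_mod_cast hk
    gcongr

theorem sum_integral_grid {f : ℝ → ℝ} (hf : Continuous f) (t : ℝ) {n : ℕ} (hn : 0 < n) :
    ∑ k ∈ Finset.range n, ∫ s in (t * (k : ℝ) / n)..(t * ((k : ℝ) + 1) / n), f s =
      ∫ s in (0 : ℝ)..t, f s := by
  have h := intervalIntegral.sum_integral_adjacent_intervals (μ := volume) (f := f)
    (a := fun k : ℕ => t * (k : ℝ) / n) (n := n) fun k _ => hf.intervalIntegrable _ _
  have hn' : (n : ℝ) ≠ 0 := by exact_mod_cast hn.ne'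
  simpa [hn'] using h

/-- Riemann-Stieltjes sums over equidistant partitions converge to the integral. -/
theorem tendsto_sum_mul_integral {b g : ℝ → ℝ} (hb : Continuous b) (hg : Continuous g) {t : ℝ}
    (ht : 0 ≤ t) (ξ : ℕ → ℕ → ℝ)
    (hξ : ∀ n k : ℕ, k < n → ξ n k ∈ Icc (t * (k : ℝ) / n) (t * ((k : ℝ) + 1) / n)) :
    Tendsto (fun n : ℕ => ∑ k ∈ Finset.range n,
      b (ξ n k) * ∫ s in (t * (k : ℝ) / n)..(t * ((k : ℝ) + 1) / n), g s) atTop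
      (𝓝 (∫ s in (0 : ℝ)..t, b s * g s)) := by
  rw [Metric.tendsto_atTop]
  intro ε hε
  set I := ∫ s in (0 : ℝ)..t, |g s| with hI
  have hI0 : 0 ≤ I := intervalIntegral.integral_nonneg ht fun _ _ => abs_nonneg _
  set η := ε / (I + 1) with hη
  have hη0 : 0 < η := by positivity
  obtain ⟨δ, hδ, hbδ⟩ := Metric.uniformContinuousOn_iff.1
    (isCompact_Icc.uniformContinuousOn_of_continuous (hb.continuousOn (s := Icc 0 t))) η hη0
  obtain ⟨N, hN⟩ := exists_nat_gt (t / δ)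
  refine ⟨N + 1, fun n hn => ?_⟩
  have hn0 : 0 < n := by omega
  have hn' : (0 : ℝ) < n := by exact_mod_cast hn0
  have hmesh : t / n < δ := by
    rw [div_lt_iff₀ hn', mul_comm, ← div_lt_iff₀ hδ]
    refine hN.trans ?_
    exact_mod_cast hn
  rw [← sum_integral_grid (f := fun s => b s * g s) (hb.mul hg) t hn0, Real.dist_eq, ← Finset.sum_sub_distrib]
  calc |∑ k ∈ Finset.range n,
        (b (ξ n k) * (∫ s in (t * (k : ℝ) / n)..(t * ((k : ℝ) + 1) / n), g s) -
          ∫ s in (t * (k : ℝ) / n)..(t * ((k : ℝ) + 1) / n), b s * g s)| ≤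
        ∑ k ∈ Finset.range n, ∫ s in (t * (k : ℝ) / n)..(t * ((k : ℝ) + 1) / n), η * |g s| := by
        refine (Finset.abs_sum_le_sum_abs _ _).trans (Finset.sum_le_sum fun k hk => ?_)
        have hk := Finset.mem_range.1 hk
        have hle : t * (k : ℝ) / n ≤ t * ((k : ℝ) + 1) / n := by gcongr; linarith
        have h0 : 0 ≤ t * (k : ℝ) / n := by positivity
        have h1 : t * ((k : ℝ) + 1) / n ≤ t := by
          have := (grid_mem ht (Nat.succ_le_of_lt hk)).2
          push_cast at this
          exact this
        rw [← intervalIntegral.integral_const_mul, ← intervalIntegral.integral_sub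
          (Continuous.intervalIntegrable (by fun_prop) _ _)
          (Continuous.intervalIntegrable (by fun_prop) _ _)]
        refine (intervalIntegral.abs_integral_le_integral_abs hle).trans ?_
        refine intervalIntegral.integral_mono_on hle
          (Continuous.intervalIntegrable (by fun_prop) _ _)
          (Continuous.intervalIntegrable (by fun_prop) _ _) fun s hs => ?_
        rw [← sub_mul, abs_mul]
        refine mul_le_mul_of_nonneg_right ?_ (abs_nonneg _)
        have hξk := hξ n k hk
        have hd : dist (ξ n k) s < δ := by
          refine lt_of_le_of_lt ?_ hmesh
          have : t * ((k : ℝ) + 1) / n = t * (k : ℝ) / n + t / n := by ring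
          rw [Real.dist_eq, abs_le]
          constructor <;> linarith [hξk.1, hξk.2, hs.1, hs.2]
        exact (hbδ _ ⟨h0.trans hξk.1, hξk.2.trans h1⟩ _ ⟨h0.trans hs.1, hs.2.trans h1⟩ hd).le
    _ = η * I := by
        rw [sum_integral_grid (f := fun s => η * |g s|) (by fun_prop) t hn0,
          intervalIntegral.integral_const_mul]
    _ < η * (I + 1) := by linarith
    _ = ε := by rw [hη]; field_simp

/-- The integral `∫₀ᵗ G db` of a `C¹` integrand `G` with derivative `g` along a continuous path `b`
with `b(0) = 0`, defined by integration by parts. -/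
def pathIntegral (G g b : ℝ → ℝ) (t : ℝ) : ℝ := G t * b t - ∫ s in (0 : ℝ)..t, g s * b s

theorem continuous_pathIntegral {G g b : ℝ → ℝ} (hG : Continuous G) (hg : Continuous g)
    (hb : Continuous b) : Continuous (pathIntegral G g b) :=
  (hG.mul hb).sub (continuous_primitive_zero (hg.mul hb))

/-- Abel summation turns left-point sums of `G db` into right-point sums of `b dG`, whose integrator
is `C¹`; hence continuity of `b` is enough. -/
theorem tendsto_leftSum {G g b : ℝ → ℝ} (hG : ∀ t, HasDerivAt G (g t) t) (hg : Continuous g)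
    (hb : Continuous b) (hb0 : b 0 = 0) {t : ℝ} (ht : 0 ≤ t) :
    Tendsto (fun n : ℕ => ∑ k ∈ Finset.range n, G (t * (k : ℝ) / n) *
      (b (t * ((k : ℝ) + 1) / n) - b (t * (k : ℝ) / n))) atTop (𝓝 (pathIntegral G g b t)) := by
  have h1 := tendsto_sum_mul_integral hb hg ht (fun n k => t * ((k : ℝ) + 1) / n)
    fun n k _ => ⟨by gcongr; linarith, le_rfl⟩
  have h2 := h1.const_sub (G t * b t)
  have h3 : G t * b t - ∫ s in (0 : ℝ)..t, b s * g s = pathIntegral G g b t := by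
    simp only [pathIntegral, mul_comm]
  rw [h3] at h2
  refine h2.congr' ?_
  filter_upwards [eventually_gt_atTop 0] with n hn
  have hn' : (n : ℝ) ≠ 0 := by exact_mod_cast hn.ne'
  have h4 := Finset.sum_range_sub (fun k : ℕ => G (t * (k : ℝ) / n) * b (t * (k : ℝ) / n)) n
  simp only [mul_div_assoc, div_self hn', mul_one, Nat.cast_zero, zero_div, mul_zero, hb0,
    sub_zero] at h4
  rw [← h4, ← Finset.sum_sub_distrib]
  refine Finset.sum_congr rfl fun k _ => ?_
  rw [intervalIntegral.integral_eq_sub_of_hasDerivAt (fun x _ => hG x)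
    (hg.intervalIntegrable _ _)]
  push_cast
  simp only [mul_div_assoc]
  ring

/-! ### The linear wealth equation along a fixed path. -/

theorem hasDerivAt_discount (r t : ℝ) :
    HasDerivAt (fun t => Real.exp (-(r * t))) (-r * Real.exp (-(r * t))) t := by
  have h : HasDerivAt (fun t : ℝ => -(r * t)) (-r) t := by
    simpa using! ((hasDerivAt_id t).const_mul r).neg
  convert h.exp using 1
  ring

/-- Variation of constants for `dx = (r x + v P) dt + σ P db` along a continuous path `b`. -/
theorem eq_exp_mul_of_linear_integral_eq {r v σ x₁ T : ℝ} (hT : 0 ≤ T) {P p b x : ℝ → ℝ}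
    (hP : ∀ t, HasDerivAt P (p t) t) (hp : Continuous p) (hb : Continuous b)
    (hx : ContinuousOn x (Icc 0 T))
    (heq : ∀ t ∈ Icc 0 T, x t = x₁ + (∫ s in (0 : ℝ)..t, (r * x s + v * P s)) +
      σ * pathIntegral P p b t) :
    x T = Real.exp (r * T) * (x₁ + v * (∫ s in (0 : ℝ)..T, Real.exp (-(r * s)) * P s) +
      σ * pathIntegral (fun s => Real.exp (-(r * s)) * P s)
        (fun s => -r * Real.exp (-(r * s)) * P s + Real.exp (-(r * s)) * p s) b T) := by
  have hPc : Continuous P := continuous_of_hasDerivAt hP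
  set y := IccExtend hT ((Icc 0 T).domRestrict x) with hy
  have hyc : Continuous y := (continuousOn_iff_continuous_domRestrict.1 hx).Icc_extend'
  have hyx : ∀ t ∈ Icc 0 T, y t = x t := fun t ht => IccExtend_of_mem _ _ ht
  -- `u` is `x` without the possibly nondifferentiable part `σ P b` (see `hxu`), so the integrating
  -- factor can be applied by ordinary calculus.
  set u := fun t => x₁ + ∫ s in (0 : ℝ)..t, (r * y s + v * P s - σ * (p s * b s)) with hu
  have hud : ∀ t, HasDerivAt u (r * y t + v * P t - σ * (p t * b t)) t := fun t =>
    (hasDerivAt_primitive (by fun_prop) t).const_add _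
  have hxu : ∀ t ∈ Icc 0 T, x t = u t + σ * (P t * b t) := by
    intro t ht
    have h1 : ∫ s in (0 : ℝ)..t, (r * x s + v * P s) = ∫ s in (0 : ℝ)..t, (r * y s + v * P s) := by
      refine intervalIntegral.integral_congr fun s hs => ?_
      rw [uIcc_of_le ht.1] at hs
      simp only [hyx s ⟨hs.1, hs.2.trans ht.2⟩]
    rw [heq t ht, h1, hu]
    simp only [pathIntegral]
    rw [intervalIntegral.integral_sub (Continuous.intervalIntegrable (by fun_prop) _ _)
      (Continuous.intervalIntegrable (by fun_prop) _ _), intervalIntegral.integral_const_mul]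
    ring
  have huc : Continuous u := continuous_of_hasDerivAt hud
  have h2 := intervalIntegral.integral_eq_sub_of_hasDerivAt (a := 0) (b := T)
    (fun t _ => (hasDerivAt_discount r t).mul (hud t))
    (Continuous.intervalIntegrable (by fun_prop) _ _)
  have h3 : ∫ t in (0 : ℝ)..T, (-r * Real.exp (-(r * t)) * u t +
        Real.exp (-(r * t)) * (r * y t + v * P t - σ * (p t * b t))) =
      v * (∫ s in (0 : ℝ)..T, Real.exp (-(r * s)) * P s) - σ * ∫ s in (0 : ℝ)..T,
        (-r * Real.exp (-(r * s)) * P s + Real.exp (-(r * s)) * p s) * b s := by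
    rw [← intervalIntegral.integral_const_mul, ← intervalIntegral.integral_const_mul,
      ← intervalIntegral.integral_sub (Continuous.intervalIntegrable (by fun_prop) _ _)
      (Continuous.intervalIntegrable (by fun_prop) _ _)]
    refine intervalIntegral.integral_congr fun t ht => ?_
    rw [uIcc_of_le hT] at ht
    simp only [hyx t ht, hxu t ht]
    ring
  have hTm : T ∈ Icc 0 T := ⟨hT, le_rfl⟩
  rw [h3] at h2
  have hu0 : u 0 = x₁ := by simp [hu]
  simp only [Pi.mul_apply, hu0, mul_zero, neg_zero, Real.exp_zero, one_mul] at h2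
  have h4 : Real.exp (r * T) * Real.exp (-(r * T)) = 1 := by rw [← Real.exp_add]; simp
  rw [hxu T hTm]
  simp only [pathIntegral]
  linear_combination (-(u T) - σ * P T * b T) * h4 - Real.exp (r * T) * h2

/-- Existence for `dx = (r x + v P) dt + σ P db` along a continuous path `b`. -/
theorem exists_linear_integral_eq (r v σ x₁ : ℝ) {P p b : ℝ → ℝ}
    (hP : ∀ t, HasDerivAt P (p t) t) (hp : Continuous p) (hb : Continuous b) :
    ∃ x : ℝ → ℝ, Continuous x ∧ ∀ t, x t = x₁ + (∫ s in (0 : ℝ)..t, (r * x s + v * P s)) +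
      σ * pathIntegral P p b t := by
  have hPc : Continuous P := continuous_of_hasDerivAt hP
  -- Again `u = x - σ P b`, which must solve `u' = r u + v P - σ b (p - r P)`. The double negation
  -- lets `hasDerivAt_discount` apply with rate `-r`.
  set u := fun t => Real.exp (-(-r * t)) * (x₁ + ∫ s in (0 : ℝ)..t,
    Real.exp (-(r * s)) * (v * P s - σ * (b s * (p s - r * P s)))) with hu
  have hud : ∀ t, HasDerivAt u (r * (u t + σ * (P t * b t)) + v * P t - σ * (p t * b t)) t := by
    intro t
    have h := (hasDerivAt_discount (-r) t).mul ((hasDerivAt_primitive (u := fun s =>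
      Real.exp (-(r * s)) * (v * P s - σ * (b s * (p s - r * P s)))) (by fun_prop) t).const_add x₁)
    refine HasDerivAt.congr_deriv (f := u) h ?_
    have h4 : Real.exp (-(-r * t)) * Real.exp (-(r * t)) = 1 := by
      rw [← Real.exp_add]; simp
    simp only [hu]
    linear_combination (v * P t - σ * (b t * (p t - r * P t))) * h4
  have huc : Continuous u := continuous_of_hasDerivAt hud
  refine ⟨fun t => u t + σ * (P t * b t), by fun_prop, fun t => ?_⟩
  have h2 := intervalIntegral.integral_eq_sub_of_hasDerivAt (a := 0) (b := t)
    (fun t _ => hud t) (Continuous.intervalIntegrable (by fun_prop) _ _)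
  rw [intervalIntegral.integral_sub (Continuous.intervalIntegrable (by fun_prop) _ _)
      (Continuous.intervalIntegrable (by fun_prop) _ _), intervalIntegral.integral_const_mul] at h2
  have hu0 : u 0 = x₁ := by simp [hu]
  simp only [pathIntegral]
  linarith

/-! ### Wiener integrals of `C¹` functions and their Gaussian law. -/

section

variable {Ω : Type*} [MeasurableSpace Ω]

/-- The path of `W` at `ω`, extended by a constant to negative times. -/
def path (W : ℝ≥0 → Ω → ℝ) (ω : Ω) (t : ℝ) : ℝ := W t.toNNReal ω

theorem ae_continuous_path {W : ℝ≥0 → Ω → ℝ} {μ : Measure Ω} (hW : IsBrownianReal W μ) :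
    ∀ᵐ ω ∂μ, Continuous (path W ω) ∧ path W ω 0 = 0 := by
  filter_upwards [hW.cont, hW.eval_zero_ae_eq_zero] with ω h1 h2
  exact ⟨h1.comp continuous_real_toNNReal, by simp [path, h2]⟩

theorem aemeasurable_leftSum {W : ℝ≥0 → Ω → ℝ} {μ : Measure Ω} (hW : IsBrownianReal W μ)
    (H : ℝ → ℝ) (t : ℝ) (n : ℕ) :
    AEMeasurable (fun ω => ∑ k ∈ Finset.range n, H (t * (k : ℝ) / (n : ℝ)) *
      (W (t * ((k : ℝ) + 1) / (n : ℝ)).toNNReal ω - W (t * (k : ℝ) / (n : ℝ)).toNNReal ω)) μ :=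
  Finset.aemeasurable_fun_sum _ fun _ _ =>
    ((hW.aemeasurable _).sub (hW.aemeasurable _)).const_mul _

theorem ae_tendsto_leftSum {W : ℝ≥0 → Ω → ℝ} {μ : Measure Ω} (hW : IsBrownianReal W μ)
    {H h : ℝ → ℝ} (hH : ∀ t, HasDerivAt H (h t) t) (hh : Continuous h) {t : ℝ} (ht : 0 ≤ t) :
    ∀ᵐ ω ∂μ, Tendsto (fun n : ℕ => ∑ k ∈ Finset.range n, H (t * (k : ℝ) / (n : ℝ)) *
      (W (t * ((k : ℝ) + 1) / (n : ℝ)).toNNReal ω - W (t * (k : ℝ) / (n : ℝ)).toNNReal ω)) atTop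
      (𝓝 (pathIntegral H h (path W ω) t)) := by
  filter_upwards [ae_continuous_path hW] with ω hω
  exact tendsto_leftSum hH hh hω.1 hω.2 ht

theorem isItoIntegral_pathIntegral {W : ℝ≥0 → Ω → ℝ} {μ : Measure Ω} [IsProbabilityMeasure μ]
    (hW : IsBrownianReal W μ) (T : ℝ) {H h : ℝ → ℝ} (hH : ∀ t, HasDerivAt H (h t) t)
    (hh : Continuous h) :
    IsItoIntegral W μ T H fun t ω => pathIntegral H h (path W ω) t where
  cont := by
    filter_upwards [ae_continuous_path hW] with ω hω
    exact (continuous_pathIntegral (continuous_of_hasDerivAt hH) hh hω.1).continuousOn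
  tendsto t ht := tendstoInMeasure_of_tendsto_ae
    (fun n => (aemeasurable_leftSum hW H t n).aestronglyMeasurable)
    (ae_tendsto_leftSum hW hH hh ht.1)

theorem IsItoIntegral.congr {W : ℝ≥0 → Ω → ℝ} {μ : Measure Ω} {T : ℝ} {H H' : ℝ → ℝ}
    {M : ℝ → Ω → ℝ} (hM : IsItoIntegral W μ T H M) (hHH' : EqOn H H' (Icc 0 T)) :
    IsItoIntegral W μ T H' M where
  cont := hM.cont
  tendsto t ht := by
    refine TendstoInMeasure.congr_left (fun n => Eventually.of_forall fun ω => ?_)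
      (hM.tendsto t ht)
    refine Finset.sum_congr rfl fun k hk => ?_
    have hk' := grid_mem ht.1 (Finset.mem_range.1 hk).le
    rw [hHH' ⟨hk'.1, hk'.2.trans ht.2⟩]

/-- The stochastic integral process is unique up to indistinguishability. -/
theorem IsItoIntegral.ae_eqOn {W : ℝ≥0 → Ω → ℝ} {μ : Measure Ω} {T : ℝ} {H : ℝ → ℝ}
    {M M' : ℝ → Ω → ℝ} (hM : IsItoIntegral W μ T H M) (hM' : IsItoIntegral W μ T H M') :
    ∀ᵐ ω ∂μ, ∀ t ∈ Icc 0 T, M t ω = M' t ω := by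
  -- Limits in probability determine the process almost surely at each fixed time; a countable dense
  -- set of times and path continuity give one null set for all times.
  obtain ⟨D, hDc, hD⟩ := TopologicalSpace.exists_countable_dense (Icc (0 : ℝ) T)
  have h1 : ∀ᵐ ω ∂μ, ∀ t ∈ D, M (t : Icc (0 : ℝ) T) ω = M' (t : Icc (0 : ℝ) T) ω :=
    (ae_ball_iff hDc).2 fun t _ =>
      tendstoInMeasure_ae_unique (hM.tendsto t t.2) (hM'.tendsto t t.2)
  filter_upwards [h1, hM.cont, hM'.cont] with ω hω h2 h3 t ht
  have h4 := Continuous.ext_on hD (continuousOn_iff_continuous_domRestrict.1 h2)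
    (continuousOn_iff_continuous_domRestrict.1 h3) fun t ht => hω t ht
  exact congrFun h4 ⟨t, ht⟩

/-- Independent Gaussian increments give a product of Gaussian characteristic functions. The mesh
length is written as an integral of `1` so that `tendsto_sum_mul_integral` applies to the variance.
-/
theorem charFun_map_leftSum {W : ℝ≥0 → Ω → ℝ} {μ : Measure Ω} (hW : IsBrownianReal W μ)
    (G : ℝ → ℝ) {t : ℝ} (ht : 0 ≤ t) (n : ℕ) (x : ℝ) :
    charFun (μ.map fun ω => ∑ k ∈ Finset.range n, G (t * (k : ℝ) / (n : ℝ)) *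
      (W (t * ((k : ℝ) + 1) / (n : ℝ)).toNNReal ω - W (t * (k : ℝ) / (n : ℝ)).toNNReal ω)) x =
    Complex.exp ((-(x ^ 2 / 2) * ∑ k ∈ Finset.range n, G (t * (k : ℝ) / (n : ℝ)) ^ 2 *
      ∫ _ in (t * (k : ℝ) / n)..(t * ((k : ℝ) + 1) / n), (1 : ℝ) : ℝ)) := by
  have hmono : Monotone fun k : ℕ => (t * (k : ℝ) / (n : ℝ)).toNNReal := fun i j hij => by
    have : (i : ℝ) ≤ j := by exact_mod_cast hij
    exact Real.toNNReal_le_toNNReal (by gcongr)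
  have hind := (hW.hasIndepIncrements.nat hmono).comp
    (fun k x => G (t * (k : ℝ) / (n : ℝ)) * x) fun k => measurable_const_mul _
  have hsum := iIndepFun.charFun_map_fun_finsetSum_eq_prod (s := Finset.range n)
    (X := fun k ω => G (t * (k : ℝ) / (n : ℝ)) *
      (W (t * ((k : ℝ) + 1) / (n : ℝ)).toNNReal ω - W (t * (k : ℝ) / (n : ℝ)).toNNReal ω))
    (P := μ)
    (fun k _ => ((hW.aemeasurable _).sub (hW.aemeasurable _)).const_mul _) (by
      have := hind.restrict (Finset.range n)
      simpa [Function.comp_def] using! this)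
  rw [hsum, Finset.prod_apply, Finset.mul_sum, Complex.ofReal_sum, Complex.exp_sum]
  refine Finset.prod_congr rfl fun k _ => ?_
  have h1 : (fun ω => G (t * (k : ℝ) / (n : ℝ)) *
      (W (t * ((k : ℝ) + 1) / (n : ℝ)).toNNReal ω - W (t * (k : ℝ) / (n : ℝ)).toNNReal ω)) =
      fun ω => G (t * (k : ℝ) / (n : ℝ)) * (W (t * ((k : ℝ) + 1) / (n : ℝ)).toNNReal -
        W (t * (k : ℝ) / (n : ℝ)).toNNReal) ω := rfl
  have h2 : (0 : ℝ) ≤ t * ((k : ℝ) + 1) / (n : ℝ) := by positivity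
  have h3 : (0 : ℝ) ≤ t * (k : ℝ) / (n : ℝ) := by positivity
  have h4 : t * (k : ℝ) / (n : ℝ) ≤ t * ((k : ℝ) + 1) / (n : ℝ) := by gcongr; linarith
  have h5 : μ.map (W (t * ((k : ℝ) + 1) / (n : ℝ)).toNNReal - W (t * (k : ℝ) / (n : ℝ)).toNNReal) =
      gaussianReal 0 (t * ((k : ℝ) + 1) / (n : ℝ) - t * (k : ℝ) / (n : ℝ)).toNNReal := by
    rw [(hW.hasLaw_sub _ _).map_eq]
    congr 1
    refine NNReal.coe_injective ?_
    rw [Real.coe_toNNReal _ (sub_nonneg.2 h4)]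
    refine (coe_nndist _ _).trans ?_
    change dist ((t * ((k : ℝ) + 1) / (n : ℝ)).toNNReal : ℝ) ((t * (k : ℝ) / (n : ℝ)).toNNReal : ℝ)
      = _
    rw [Real.coe_toNNReal _ h2, Real.coe_toNNReal _ h3, Real.dist_eq,
      abs_of_nonneg (sub_nonneg.2 h4)]
  rw [h1, charFun_map_mul_comp ((hW.aemeasurable _).sub (hW.aemeasurable _)), h5,
    charFun_gaussianReal, Real.coe_toNNReal _ (sub_nonneg.2 h4), intervalIntegral.integral_const,
    smul_eq_mul, mul_one]
  congr 1
  push_cast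
  ring

theorem tendsto_charFun_map {μ : Measure Ω} [IsProbabilityMeasure μ] {Y : ℕ → Ω → ℝ} {Z : Ω → ℝ}
    (hY : ∀ n, AEMeasurable (Y n) μ) (hZ : AEMeasurable Z μ)
    (h : ∀ᵐ ω ∂μ, Tendsto (fun n => Y n ω) atTop (𝓝 (Z ω))) (x : ℝ) :
    Tendsto (fun n => charFun (μ.map (Y n)) x) atTop (𝓝 (charFun (μ.map Z) x)) := by
  have hc : Continuous fun y : ℝ => Complex.exp (x * y * Complex.I) := by fun_prop
  have hint : ∀ Y : Ω → ℝ, AEMeasurable Y μ →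
      charFun (μ.map Y) x = ∫ ω, Complex.exp (x * Y ω * Complex.I) ∂μ := fun Y hY => by
    rw [charFun_apply_real, integral_map hY hc.aestronglyMeasurable]
  rw [hint Z hZ]
  simp_rw [fun n => hint (Y n) (hY n)]
  refine tendsto_integral_of_dominated_convergence (fun _ => 1)
    (fun n => (hc.measurable.comp_aemeasurable (hY n)).aestronglyMeasurable)
    (integrable_const _) (fun n => Eventually.of_forall fun ω => ?_) ?_
  · rw [← Complex.ofReal_mul, Complex.norm_exp_ofReal_mul_I]
  · filter_upwards [h] with ω hω
    exact (hc.tendsto _).comp hω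

/-- The Wiener integral of a `C¹` function is a centered Gaussian variable whose variance is given
by the Itô isometry. -/
theorem map_pathIntegral_eq_gaussianReal {W : ℝ≥0 → Ω → ℝ} {μ : Measure Ω}
    [IsProbabilityMeasure μ] (hW : IsBrownianReal W μ) {G g : ℝ → ℝ}
    (hG : ∀ t, HasDerivAt G (g t) t) (hg : Continuous g) {t : ℝ} (ht : 0 ≤ t) :
    μ.map (fun ω => pathIntegral G g (path W ω) t) =
      gaussianReal 0 (∫ s in (0 : ℝ)..t, G s ^ 2).toNNReal := by
  have hGc : Continuous G := continuous_of_hasDerivAt hG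
  have hlim := ae_tendsto_leftSum hW hG hg ht
  have hmeas := aemeasurable_of_tendsto_metrizable_ae atTop (aemeasurable_leftSum hW G t) hlim
  have : IsProbabilityMeasure (μ.map fun ω => pathIntegral G g (path W ω) t) :=
    Measure.isProbabilityMeasure_map hmeas
  refine Measure.ext_of_charFun (funext fun x => ?_)
  have h1 := tendsto_charFun_map (aemeasurable_leftSum hW G t) hmeas hlim x
  have h2 : Tendsto (fun n : ℕ => ∑ k ∈ Finset.range n, G (t * (k : ℝ) / (n : ℝ)) ^ 2 *
      ∫ _ in (t * (k : ℝ) / n)..(t * ((k : ℝ) + 1) / n), (1 : ℝ)) atTop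
      (𝓝 (∫ s in (0 : ℝ)..t, G s ^ 2 * 1)) :=
    tendsto_sum_mul_integral (b := fun s => G s ^ 2) (g := fun _ => 1) (by fun_prop) (by fun_prop)
      ht (fun n k => t * (k : ℝ) / n) fun n k _ => ⟨le_rfl, by gcongr; linarith⟩
  simp only [mul_one] at h2
  have h3 := ((Complex.continuous_exp.comp Complex.continuous_ofReal).tendsto _).comp
    (h2.const_mul (-(x ^ 2 / 2)))
  refine tendsto_nhds_unique h1 (Tendsto.congr' (Eventually.of_forall fun n => ?_) (h3.trans ?_))
  · exact (charFun_map_leftSum hW G ht n x).symm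
  · rw [charFun_gaussianReal, Real.coe_toNNReal _
      (intervalIntegral.integral_nonneg ht fun _ _ => sq_nonneg _)]
    refine le_of_eq (congrArg _ ?_)
    simp only [Function.comp]
    congr 1
    push_cast
    ring

theorem integral_exp_mul_pathIntegral {W : ℝ≥0 → Ω → ℝ} {μ : Measure Ω}
    [IsProbabilityMeasure μ] (hW : IsBrownianReal W μ) {G g : ℝ → ℝ}
    (hG : ∀ t, HasDerivAt G (g t) t) (hg : Continuous g) {t : ℝ} (ht : 0 ≤ t) (a : ℝ) :
    ∫ ω, Real.exp (a * pathIntegral G g (path W ω) t) ∂μ =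
      Real.exp ((∫ s in (0 : ℝ)..t, G s ^ 2) * a ^ 2 / 2) := by
  have := mgf_gaussianReal (map_pathIntegral_eq_gaussianReal hW hG hg ht) a
  rw [Real.coe_toNNReal _ (intervalIntegral.integral_nonneg ht fun _ _ => sq_nonneg _)] at this
  simpa [mgf] using this

/-! ### Wealth processes and expected utility. -/

theorem pathIntegral_const_mul (σ : ℝ) (P p b : ℝ → ℝ) (t : ℝ) :
    pathIntegral (fun s => σ * P s) (fun s => σ * p s) b t = σ * pathIntegral P p b t := by
  simp only [pathIntegral, mul_assoc, intervalIntegral.integral_const_mul]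
  ring

/-- The equation is solved separately for each `ω`, with the value `0` on the null set of bad paths;
choosing solutions is harmless since `IsWealth` asks for no measurability of `X` in `ω`. -/
theorem Model.exists_isWealth (m : Model) {W : ℝ≥0 → Ω → ℝ} {μ : Measure Ω}
    [IsProbabilityMeasure μ] (hW : IsBrownianReal W μ) {P p : ℝ → ℝ}
    (hP : ∀ t, HasDerivAt P (p t) t) (hp : Continuous p) : ∃ X, m.IsWealth W μ P X := by
  have h1 : ∀ ω, ∃ x : ℝ → ℝ, Continuous (path W ω) → Continuous x ∧
      ∀ t, x t = m.x₁ + (∫ s in (0 : ℝ)..t, (m.r * x s + m.v * P s)) +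
        m.σ * pathIntegral P p (path W ω) t := fun ω => by
    by_cases hb : Continuous (path W ω)
    · obtain ⟨x, hx⟩ := exists_linear_integral_eq m.r m.v m.σ m.x₁ hP hp hb
      exact ⟨x, fun _ => hx⟩
    · exact ⟨0, fun h => absurd h hb⟩
  choose X hX using h1
  refine ⟨fun t ω => X ω t, _, isItoIntegral_pathIntegral hW m.T (fun t => (hP t).const_mul m.σ)
    (hp.const_mul m.σ), ?_⟩
  filter_upwards [ae_continuous_path hW] with ω hω
  refine ⟨(hX ω hω.1).1.continuousOn, fun t _ => ?_⟩
  rw [pathIntegral_const_mul]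
  exact (hX ω hω.1).2 t

/-- By uniqueness of the stochastic integral, every wealth process almost surely follows the
pathwise solution, so the utility is the exponential of an affine function of a Gaussian variable.
-/
theorem Model.integral_utility (m : Model) (hT : 0 < m.T) {W : ℝ≥0 → Ω → ℝ} {μ : Measure Ω}
    [IsProbabilityMeasure μ] (hW : IsBrownianReal W μ) {P p : ℝ → ℝ}
    (hP : ∀ t, HasDerivAt P (p t) t) (hp : Continuous p) {X : ℝ → Ω → ℝ}
    (hX : m.IsWealth W μ P X) :
    ∫ ω, utility m.α₁ (X m.T ω) ∂μ = -(1 / m.α₁) * Real.exp (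
      -m.α₁ * (Real.exp (m.r * m.T) *
        (m.x₁ + m.v * ∫ s in (0 : ℝ)..m.T, Real.exp (-(m.r * s)) * P s)) +
      (∫ s in (0 : ℝ)..m.T, (Real.exp (-(m.r * s)) * P s) ^ 2) *
        (-m.α₁ * (Real.exp (m.r * m.T) * m.σ)) ^ 2 / 2) := by
  obtain ⟨M, hM, hXM⟩ := hX
  have hPc : Continuous P := continuous_of_hasDerivAt hP
  have hG : ∀ t, HasDerivAt (fun s => Real.exp (-(m.r * s)) * P s)
      (-m.r * Real.exp (-(m.r * t)) * P t + Real.exp (-(m.r * t)) * p t) t := fun t =>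
    (hasDerivAt_discount m.r t).mul (hP t)
  have hM' := hM.ae_eqOn (isItoIntegral_pathIntegral hW m.T (fun t => (hP t).const_mul m.σ)
    (hp.const_mul m.σ))
  rw [Real.exp_add, ← integral_exp_mul_pathIntegral hW hG (by fun_prop) hT.le, ← mul_assoc,
    ← integral_const_mul]
  refine integral_congr_ae ?_
  filter_upwards [ae_continuous_path hW, hXM, hM'] with ω hω h1 h2
  have h3 := eq_exp_mul_of_linear_integral_eq hT.le hP hp hω.1 h1.1 fun t ht => by
    rw [h1.2 t ht, h2 t ht, pathIntegral_const_mul]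
  rw [utility, h3, mul_assoc (-(1 / m.α₁)), ← Real.exp_add]
  congr 2
  ring

end

/-! ### Feasible decisions as deviations from the rational one. -/

theorem Model.hasDerivAt_rational (m : Model) (α t : ℝ) :
    HasDerivAt (m.rational α) (m.v / (α * m.σ ^ 2) * (m.r * Real.exp (m.r * (t - m.T)))) t := by
  have h : HasDerivAt (fun t => m.r * (t - m.T)) m.r t := by
    simpa using ((hasDerivAt_id t).sub_const m.T).const_mul m.r
  have h2 := h.exp.const_mul (m.v / (α * m.σ ^ 2))
  rw [mul_comm (Real.exp _) m.r] at h2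
  exact h2

/-- A `C¹` function on a compact interval coincides there with a `C¹` function on the line. -/
theorem exists_hasDerivAt_eqOn {T : ℝ} (hT : 0 < T) {P : ℝ → ℝ}
    (hP : ContDiffOn ℝ 1 P (Icc 0 T)) :
    ∃ Q q : ℝ → ℝ, (∀ t, HasDerivAt Q (q t) t) ∧ Continuous q ∧ EqOn P Q (Icc 0 T) := by
  have hc : ContinuousOn (derivWithin P (Icc 0 T)) (Icc 0 T) :=
    hP.continuousOn_derivWithin (uniqueDiffOn_Icc hT) le_rfl
  set q := IccExtend hT.le ((Icc 0 T).domRestrict (derivWithin P (Icc 0 T))) with hq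
  have hqc : Continuous q := (continuousOn_iff_continuous_domRestrict.1 hc).Icc_extend'
  have hqP : ∀ t ∈ Icc 0 T, q t = derivWithin P (Icc 0 T) t := fun t ht => IccExtend_of_mem _ _ ht
  refine ⟨fun t => P 0 + ∫ s in (0 : ℝ)..t, q s, q,
    fun t => (hasDerivAt_primitive hqc t).const_add _, hqc, fun t ht => ?_⟩
  have h := intervalIntegral.integral_eq_sub_of_hasDerivAt_of_le (f := P) (f' := q) ht.1
    (hP.continuousOn.mono (Icc_subset_Icc_right ht.2)) (fun s hs => ?_)
    (hqc.intervalIntegrable _ _)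
  · simp only [h]; ring
  · have hs' : s ∈ Ioo 0 T := ⟨hs.1, hs.2.trans_le ht.2⟩
    have hnhds : Icc 0 T ∈ 𝓝 s := Icc_mem_nhds hs'.1 hs'.2
    rw [hqP s (Ioo_subset_Icc_self hs'), derivWithin_of_mem_nhds hnhds]
    exact ((hP.contDiffAt hnhds).differentiableAt one_ne_zero).hasDerivAt

/-- A `C¹` deviation from the rational decision, vanishing at both ends of the period. -/
structure IsDeviation (T : ℝ) (f f' : ℝ → ℝ) : Prop where
  hasDerivAt : ∀ t, HasDerivAt f (f' t) t
  continuous_deriv : Continuous f'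
  initial : f 0 = 0
  terminal : f T = 0

theorem IsDeviation.continuous {T : ℝ} {f f' : ℝ → ℝ} (hf : IsDeviation T f f') : Continuous f :=
  continuous_of_hasDerivAt hf.hasDerivAt

theorem Model.Feasible.exists_isDeviation {m : Model} (hT : 0 < m.T) {P : ℝ → ℝ}
    (hP : m.Feasible P) : ∃ f f' : ℝ → ℝ, IsDeviation m.T f f' ∧
      EqOn P (fun t => m.rational m.α₁ t + f t) (Icc 0 m.T) := by
  obtain ⟨Q, q, hQ, hq, hPQ⟩ := exists_hasDerivAt_eqOn hT hP.contDiff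
  refine ⟨fun t => Q t - m.rational m.α₁ t, _,
    ⟨fun t => (hQ t).sub (m.hasDerivAt_rational m.α₁ t), by fun_prop, ?_, ?_⟩,
    fun t ht => by simp [hPQ ht]⟩
  · simp only [← hPQ ⟨le_rfl, hT.le⟩, hP.initial, Model.rational]
    simp
  · simp only [← hPQ ⟨hT.le, le_rfl⟩, hP.terminal, Model.rational]
    simp

theorem Model.feasible_add {m : Model} {f f' : ℝ → ℝ} (hf : IsDeviation m.T f f') :
    m.Feasible fun t => m.rational m.α₁ t + f t where
  contDiff := by
    have hc := hf.continuous_deriv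
    have hd : ∀ t, HasDerivAt (fun t => m.rational m.α₁ t + f t) _ t := fun t =>
      (m.hasDerivAt_rational m.α₁ t).add (hf.hasDerivAt t)
    refine ContDiff.contDiffOn (contDiff_one_iff_deriv.2 ⟨fun t => (hd t).differentiableAt, ?_⟩)
    rw [funext fun t => (hd t).deriv]
    fun_prop
  initial := by simp [hf.initial, Model.rational]
  terminal := by simp [hf.terminal, Model.rational]

/-! ### Reduction of the objective to the penalized cost. -/

section

variable {Ω : Type*} [MeasurableSpace Ω]

theorem Model.IsWealth.congr {m : Model} {W : ℝ≥0 → Ω → ℝ} {μ : Measure Ω} {P Q : ℝ → ℝ}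
    {X : ℝ → Ω → ℝ} (hX : m.IsWealth W μ P X) (hPQ : EqOn P Q (Icc 0 m.T)) :
    m.IsWealth W μ Q X := by
  obtain ⟨M, hM, hXM⟩ := hX
  refine ⟨M, hM.congr fun t ht => by simp only [hPQ ht], ?_⟩
  filter_upwards [hXM] with ω hω
  refine ⟨hω.1, fun t ht => ?_⟩
  rw [hω.2 t ht]
  congr 2
  refine intervalIntegral.integral_congr fun s hs => ?_
  rw [uIcc_of_le ht.1] at hs
  simp only [hPQ ⟨hs.1, hs.2.trans ht.2⟩]

/-- The weight with which a deviation at time `t` enters the variance of the terminal wealth. -/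
def Model.weight (m : Model) (t : ℝ) : ℝ := (Real.exp (m.r * m.T) * Real.exp (-(m.r * t))) ^ 2

/-- The scale of the expected disutility. -/
def Model.scale (m : Model) : ℝ := 1 / m.α₁ * Real.exp (-m.α₁ * Real.exp (m.r * m.T) * m.x₁ -
  m.α₁ * m.v * (m.v / (m.α₁ * m.σ ^ 2)) * m.T / 2)

/-- Difference of the terminal values of the two rational decisions. -/
def Model.gap (m : Model) : ℝ := m.v / (m.α₁ * m.σ ^ 2) - m.v / (m.α₂ * m.σ ^ 2)

/-- The deviation with boundary values `0` which imitates the expert's rate best. -/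
def Model.imitation (m : Model) (t : ℝ) : ℝ :=
  m.gap * ((1 - t / m.T) * Real.exp (-(m.r * m.T)) + t / m.T - Real.exp (m.r * (t - m.T)))

/-- The derivative of `Model.imitation`. -/
def Model.imitationRate (m : Model) (t : ℝ) : ℝ :=
  m.gap * ((1 - Real.exp (-(m.r * m.T))) / m.T - m.r * Real.exp (m.r * (t - m.T)))

theorem Model.isDeviation_imitation {m : Model} (hT : 0 < m.T) :
    IsDeviation m.T m.imitation m.imitationRate where
  hasDerivAt t := by
    have h1 : HasDerivAt (fun t => m.r * (t - m.T)) m.r t := by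
      simpa using ((hasDerivAt_id t).sub_const m.T).const_mul m.r
    have h2 : HasDerivAt (fun t => t / m.T) (1 / m.T) t := (hasDerivAt_id t).div_const m.T
    have h3 := ((((h2.const_sub 1).mul_const (Real.exp (-(m.r * m.T)))).add h2).sub
      h1.exp).const_mul m.gap
    refine HasDerivAt.congr_deriv (f := m.imitation) h3 ?_
    simp only [imitationRate]
    ring
  continuous_deriv := by unfold imitationRate; fun_prop
  initial := by simp [imitation]
  terminal := by simp [imitation, hT.ne']

theorem Model.continuous_weight (m : Model) : Continuous m.weight := by
  unfold Model.weight; fun_prop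

theorem Model.weight_nonneg (m : Model) (t : ℝ) : 0 ≤ m.weight t := sq_nonneg _

theorem Model.disparity_eq {m : Model} (hT : 0 < m.T) {f f' P : ℝ → ℝ}
    (hf : IsDeviation m.T f f')
    (hP : EqOn P (fun t => m.rational m.α₁ t + f t) (Icc 0 m.T)) :
    m.disparity (m.rate P) (m.rate (m.rational m.α₂)) =
      1 / 2 * (∫ t in (0 : ℝ)..m.T, (f' t - m.imitationRate t) ^ 2) +
        1 / 2 * (m.gap * (1 - Real.exp (-(m.r * m.T))) / m.T) ^ 2 * m.T := by
  have hf₀ := m.isDeviation_imitation hT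
  have hf'c := hf.continuous_deriv
  have hf₀c := hf₀.continuous_deriv
  -- `c` is the mean over `[0, T]` of the difference of the two rates, fixed by the boundary values.
  set c := m.gap * (1 - Real.exp (-(m.r * m.T))) / m.T with hc
  have h1 : ∫ t in (0 : ℝ)..m.T, (m.rate P t - m.rate (m.rational m.α₂) t) ^ 2 =
      ∫ t in (0 : ℝ)..m.T, ((f' t - m.imitationRate t) ^ 2 +
        2 * c * (f' t - m.imitationRate t) + c ^ 2) := by
    refine intervalIntegral.integral_congr fun t ht => ?_
    rw [uIcc_of_le hT.le] at ht
    have hu := uniqueDiffOn_Icc hT t ht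
    have h2 : m.rate P t =
        m.v / (m.α₁ * m.σ ^ 2) * (m.r * Real.exp (m.r * (t - m.T))) + f' t := by
      rw [Model.rate, derivWithin_congr hP (hP ht)]
      exact ((m.hasDerivAt_rational m.α₁ t).add
        (hf.hasDerivAt t)).hasDerivWithinAt.derivWithin hu
    have h3 : m.rate (m.rational m.α₂) t =
        m.v / (m.α₂ * m.σ ^ 2) * (m.r * Real.exp (m.r * (t - m.T))) :=
      (m.hasDerivAt_rational m.α₂ t).hasDerivWithinAt.derivWithin hu
    simp only [h2, h3, hc, Model.imitationRate, Model.gap]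
    ring
  have h4 : ∫ t in (0 : ℝ)..m.T, (f' t - m.imitationRate t) = 0 := by
    rw [intervalIntegral.integral_eq_sub_of_hasDerivAt
      (fun t _ => (hf.hasDerivAt t).sub (hf₀.hasDerivAt t))
      (Continuous.intervalIntegrable (by fun_prop) _ _)]
    simp [hf.initial, hf.terminal, hf₀.initial, hf₀.terminal]
  rw [Model.disparity, h1, intervalIntegral.integral_add
    (Continuous.intervalIntegrable (by fun_prop) _ _)
    (Continuous.intervalIntegrable (by fun_prop) _ _), intervalIntegral.integral_add
    (Continuous.intervalIntegrable (by fun_prop) _ _)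
    (Continuous.intervalIntegrable (by fun_prop) _ _), intervalIntegral.integral_const_mul, h4,
    intervalIntegral.integral_const, smul_eq_mul]
  ring

/-- The discounted rational decision is the constant `g₀ * a`. With `v = α₁ σ² g₀`, the drift and
variance contributions linear in `f` cancel, so only the quadratic term survives. -/
theorem Model.integral_utility_eq {m : Model} (hT : 0 < m.T) (hσ : 0 < m.σ) (hα₁ : 0 < m.α₁)
    {W : ℝ≥0 → Ω → ℝ} {μ : Measure Ω} [IsProbabilityMeasure μ] (hW : IsBrownianReal W μ)
    {f f' P : ℝ → ℝ} (hf : IsDeviation m.T f f')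
    (hP : EqOn P (fun t => m.rational m.α₁ t + f t) (Icc 0 m.T)) {X : ℝ → Ω → ℝ}
    (hX : m.IsWealth W μ P X) :
    ∫ ω, utility m.α₁ (X m.T ω) ∂μ = -(m.scale *
      Real.exp (m.α₁ ^ 2 * m.σ ^ 2 / 2 * ∫ t in (0 : ℝ)..m.T, m.weight t * f t ^ 2)) := by
  have hfc := hf.continuous
  have hf'c := hf.continuous_deriv
  set g₀ := m.v / (m.α₁ * m.σ ^ 2) with hg₀
  set a := Real.exp (-(m.r * m.T)) with ha
  set S := Real.exp (m.r * m.T) with hS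
  have haS : S * a = 1 := by rw [ha, hS, ← Real.exp_add]; simp
  have hg₀v : m.α₁ * m.σ ^ 2 * g₀ = m.v := by rw [hg₀]; field_simp
  have h1 : ∀ s, Real.exp (-(m.r * s)) * (m.rational m.α₁ s + f s) =
      Real.exp (-(m.r * s)) * f s + g₀ * a := by
    intro s
    have : Real.exp (-(m.r * s)) * Real.exp (m.r * (s - m.T)) = a := by
      rw [ha, ← Real.exp_add]; congr 1; ring
    rw [Model.rational, ← hg₀, ← this]
    ring
  set F₁ := ∫ s in (0 : ℝ)..m.T, Real.exp (-(m.r * s)) * f s with hF₁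
  set F₂ := ∫ s in (0 : ℝ)..m.T, (Real.exp (-(m.r * s)) * f s) ^ 2 with hF₂
  have h2 : ∫ s in (0 : ℝ)..m.T, (Real.exp (-(m.r * s)) * f s + g₀ * a) = F₁ + g₀ * a * m.T := by
    rw [intervalIntegral.integral_add (Continuous.intervalIntegrable (by fun_prop) _ _)
      (Continuous.intervalIntegrable (by fun_prop) _ _), intervalIntegral.integral_const,
      smul_eq_mul]
    ring
  have h3 : ∫ s in (0 : ℝ)..m.T, (Real.exp (-(m.r * s)) * f s + g₀ * a) ^ 2 =
      F₂ + 2 * (g₀ * a) * F₁ + (g₀ * a) ^ 2 * m.T := by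
    have : ∀ s, (Real.exp (-(m.r * s)) * f s + g₀ * a) ^ 2 = (Real.exp (-(m.r * s)) * f s) ^ 2 +
        2 * (g₀ * a) * (Real.exp (-(m.r * s)) * f s) + (g₀ * a) ^ 2 := fun s => by ring
    simp only [this]
    rw [intervalIntegral.integral_add (Continuous.intervalIntegrable (by fun_prop) _ _)
      (Continuous.intervalIntegrable (by fun_prop) _ _), intervalIntegral.integral_add
      (Continuous.intervalIntegrable (by fun_prop) _ _)
      (Continuous.intervalIntegrable (by fun_prop) _ _), intervalIntegral.integral_const_mul,
      intervalIntegral.integral_const, smul_eq_mul]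
    ring
  have h4 : ∫ t in (0 : ℝ)..m.T, m.weight t * f t ^ 2 = S ^ 2 * F₂ := by
    rw [hF₂, ← intervalIntegral.integral_const_mul]
    refine intervalIntegral.integral_congr fun t _ => ?_
    simp only [Model.weight, ← hS]
    ring
  rw [m.integral_utility hT hW (fun t => (m.hasDerivAt_rational m.α₁ t).add (hf.hasDerivAt t))
    (by fun_prop) (hX.congr hP)]
  simp only [Pi.add_apply, h1, h2, h3, h4, Model.scale, ← hS, ← hg₀]
  rw [mul_assoc (1 / m.α₁), ← Real.exp_add, neg_mul]
  congr 3
  clear_value g₀ a S F₁ F₂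
  linear_combination (m.α₁ * S * F₁ + m.α₁ * g₀ * m.T * (S * a) - m.α₁ * g₀ * m.T / 2) * hg₀v +
    (m.α₁ ^ 2 * m.σ ^ 2 * g₀ * S * F₁ + m.α₁ ^ 2 * m.σ ^ 2 * g₀ ^ 2 * m.T * (S * a - 1) / 2) * haS

/-- The objective is, up to a constant, the negative of the penalized cost of the deviation. -/
theorem Model.objective_eq {m : Model} (hT : 0 < m.T) (hσ : 0 < m.σ) (hα₁ : 0 < m.α₁)
    {W : ℝ≥0 → Ω → ℝ} {μ : Measure Ω} [IsProbabilityMeasure μ] (hW : IsBrownianReal W μ) (θ : ℝ)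
    {f f' P : ℝ → ℝ} (hf : IsDeviation m.T f f')
    (hP : EqOn P (fun t => m.rational m.α₁ t + f t) (Icc 0 m.T)) {X : ℝ → Ω → ℝ}
    (hX : m.IsWealth W μ P X) :
    m.objective μ θ P X =
      -penalizedCost m.T m.weight m.imitationRate m.scale (m.α₁ ^ 2 * m.σ ^ 2 / 2) θ f f' -
        θ / 2 * (m.gap * (1 - Real.exp (-(m.r * m.T))) / m.T) ^ 2 * m.T := by
  rw [Model.objective, m.integral_utility_eq hT hσ hα₁ hW hf hP hX, m.disparity_eq hT hf hP,
    penalizedCost]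
  ring

/-! ### Optimal decisions and their limit. -/

theorem Model.scale_pos {m : Model} (hα₁ : 0 < m.α₁) : 0 < m.scale := by
  unfold Model.scale; positivity

theorem Model.exists_isOptimal {m : Model} (hT : 0 < m.T) (hσ : 0 < m.σ) (hα₁ : 0 < m.α₁)
    {W : ℝ≥0 → Ω → ℝ} {μ : Measure Ω} [IsProbabilityMeasure μ] (hW : IsBrownianReal W μ) {θ : ℝ}
    (hθ : 0 < θ) : ∃ P, m.IsOptimal W μ θ P := by
  have hf₀ := m.isDeviation_imitation hT
  obtain ⟨f, f', h1, h2, h3, h4, hmin⟩ := exists_isMin_penalizedCost hT m.continuous_weight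
    m.weight_nonneg hf₀.hasDerivAt hf₀.continuous_deriv hf₀.initial hf₀.terminal
    (m.scale_pos hα₁) (show 0 < m.α₁ ^ 2 * m.σ ^ 2 / 2 by positivity) hθ
  have hf : IsDeviation m.T f f' := ⟨h1, h2, h3, h4⟩
  obtain ⟨X, hX⟩ := m.exists_isWealth hW
    (fun t => (m.hasDerivAt_rational m.α₁ t).add (hf.hasDerivAt t)) (by fun_prop)
  refine ⟨_, m.feasible_add hf, X, hX, fun Q Y hQ hY => ?_⟩
  obtain ⟨q, q', hq, hQq⟩ := hQ.exists_isDeviation hT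
  rw [m.objective_eq hT hσ hα₁ hW θ hq hQq hY,
    m.objective_eq hT hσ hα₁ hW θ hf (fun _ _ => rfl) hX]
  have := hmin q q' hq.hasDerivAt hq.continuous_deriv hq.initial hq.terminal
  linarith

/-- The optimal decision is compared with `rational α₁ + imitation`, a feasible competitor whose
penalty term vanishes; the bound does not involve the optimizer. -/
theorem Model.IsOptimal.sq_sub_le {m : Model} (hT : 0 < m.T) (hσ : 0 < m.σ) (hα₁ : 0 < m.α₁)
    {W : ℝ≥0 → Ω → ℝ} {μ : Measure Ω} [IsProbabilityMeasure μ] (hW : IsBrownianReal W μ) {θ : ℝ}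
    (hθ : 0 < θ) {P : ℝ → ℝ} (hP : m.IsOptimal W μ θ P) {t : ℝ} (ht : t ∈ Icc 0 m.T) :
    (P t - (m.rational m.α₁ t + m.imitation t)) ^ 2 ≤
      2 * m.T * m.scale * Real.exp (m.α₁ ^ 2 * m.σ ^ 2 / 2 *
        ∫ t in (0 : ℝ)..m.T, m.weight t * m.imitation t ^ 2) / θ := by
  have hf₀ := m.isDeviation_imitation hT
  obtain ⟨hfeas, X, hX, hmax⟩ := hP
  obtain ⟨f, f', hf, hPf⟩ := hfeas.exists_isDeviation hT
  have hc := hf₀.continuous_deriv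
  obtain ⟨Y, hY⟩ := m.exists_isWealth hW
    (fun t => (m.hasDerivAt_rational m.α₁ t).add (hf₀.hasDerivAt t)) (by fun_prop)
  have h1 := hmax _ Y (m.feasible_add hf₀) hY
  rw [m.objective_eq hT hσ hα₁ hW θ hf hPf hX,
    m.objective_eq hT hσ hα₁ hW θ hf₀ (fun _ _ => rfl) hY] at h1
  have h2 := sq_sub_le_of_penalizedCost_le hT hf₀.hasDerivAt hf₀.continuous_deriv hf₀.initial
    hf.hasDerivAt hf.continuous_deriv hf.initial (m.scale_pos hα₁) hθ (by linarith) ht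
  rw [hPf ht]
  convert h2 using 2
  ring

/-- Optimal decisions converge to the decision with the expert's rate, corrected by a constant so
as to satisfy the boundary conditions. -/
theorem Model.isAsymptotic {m : Model} (hT : 0 < m.T) (hσ : 0 < m.σ) (hα₁ : 0 < m.α₁)
    {W : ℝ≥0 → Ω → ℝ} {μ : Measure Ω} [IsProbabilityMeasure μ] (hW : IsBrownianReal W μ) :
    m.IsAsymptotic W μ fun t => m.rational m.α₁ t + m.imitation t where
  exists_optimal _ hθ := m.exists_isOptimal hT hσ hα₁ hW hθ
  tendsto Pstar hP t ht := by
    rw [tendsto_iff_norm_sub_tendsto_zero]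
    have h1 : Tendsto (fun θ => (Pstar θ t - (m.rational m.α₁ t + m.imitation t)) ^ 2) atTop
        (𝓝 0) :=
      squeeze_zero' (Eventually.of_forall fun _ => sq_nonneg _)
        ((eventually_gt_atTop 0).mono fun θ hθ => (hP θ hθ).sq_sub_le hT hσ hα₁ hW hθ ht)
        (tendsto_const_nhds.div_atTop tendsto_id)
    have h2 := (Real.continuous_sqrt.tendsto _).comp h1
    simpa [Function.comp_def, Real.sqrt_sq_eq_abs] using h2

/-- Both limits are tested on one common selection of optimal decisions, available by
`exists_optimal`; its values for `θ ≤ 0` do not matter. -/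
theorem Model.IsAsymptotic.eqOn {m : Model} {W : ℝ≥0 → Ω → ℝ} {μ : Measure Ω} {P Q : ℝ → ℝ}
    (hP : m.IsAsymptotic W μ P) (hQ : m.IsAsymptotic W μ Q) : EqOn P Q (Icc 0 m.T) := by
  have h : ∀ θ : ℝ, ∃ R : ℝ → ℝ, 0 < θ → m.IsOptimal W μ θ R := fun θ => by
    by_cases hθ : 0 < θ
    · obtain ⟨R, hR⟩ := hP.exists_optimal θ hθ
      exact ⟨R, fun _ => hR⟩
    · exact ⟨0, fun h => absurd h hθ⟩
  choose R hR using h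
  exact fun t ht => tendsto_nhds_unique (hP.tendsto R hR t ht) (hQ.tendsto R hR t ht)

end

/-! ### Comparison of the limit with the rational decisions. -/

/-- The exponential lies below its chord. -/
theorem exp_le_chord {r T t : ℝ} (hT : 0 < T) (ht : t ∈ Icc 0 T) :
    Real.exp (r * (t - T)) ≤ (1 - t / T) * Real.exp (-(r * T)) + t / T := by
  -- `r (t - T)` is the convex combination of `-rT` and `0` with weights `1 - t/T` and `t/T`.
  have h := convexOn_exp.2 (mem_univ (-(r * T))) (mem_univ (0 : ℝ))
    (sub_nonneg.2 ((div_le_one hT).2 ht.2)) (div_nonneg ht.1 hT.le) (by ring)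
  simp only [smul_eq_mul, mul_zero, add_zero, Real.exp_zero, mul_one] at h
  have h1 : (1 - t / T) * -(r * T) = r * (t - T) := by field_simp; ring
  rwa [h1] at h

theorem Model.imitation_nonneg {m : Model} (hT : 0 < m.T) (hgap : 0 ≤ m.gap) {t : ℝ}
    (ht : t ∈ Icc 0 m.T) : 0 ≤ m.imitation t :=
  mul_nonneg hgap (sub_nonneg.2 (exp_le_chord hT ht))

theorem Model.imitation_nonpos {m : Model} (hT : 0 < m.T) (hgap : m.gap ≤ 0) {t : ℝ}
    (ht : t ∈ Icc 0 m.T) : m.imitation t ≤ 0 :=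
  mul_nonpos_of_nonpos_of_nonneg hgap (sub_nonneg.2 (exp_le_chord hT ht))

theorem Model.div_lt_div_of_lt {m : Model} (hv : 0 < m.v) (hσ : 0 < m.σ) {α β : ℝ} (hα : 0 < α)
    (hαβ : α < β) : m.v / (β * m.σ ^ 2) < m.v / (α * m.σ ^ 2) := by
  gcongr

theorem Model.rational_lt_of_lt {m : Model} (hv : 0 < m.v) (hσ : 0 < m.σ) {α β : ℝ} (hα : 0 < α)
    (hαβ : α < β) (t : ℝ) : m.rational β t < m.rational α t :=
  mul_lt_mul_of_pos_right (m.div_lt_div_of_lt hv hσ hα hαβ) (Real.exp_pos _)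

end DecisionImitation

end

theorem theorem5 {Ω : Type*} [MeasurableSpace Ω] (μ : Measure Ω) [IsProbabilityMeasure μ]
    (W : ℝ≥0 → Ω → ℝ) (hW : IsBrownianReal W μ)
    (m : DecisionImitation.Model) (hv : 0 < m.v) (hσ : 0 < m.σ) (hT : 0 < m.T)
    (hα₁ : 0 < m.α₁) (hα₂ : 0 < m.α₂) :
    (∃ Pinf : ℝ → ℝ, m.IsAsymptotic W μ Pinf) ∧
    ∀ Pinf : ℝ → ℝ, m.IsAsymptotic W μ Pinf → ∀ t ∈ Icc 0 m.T,
      (m.α₁ < m.α₂ →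
        Pinf t ≥ m.rational m.α₁ t ∧ m.rational m.α₁ t > m.rational m.α₂ t) ∧
      (m.α₁ > m.α₂ →
        Pinf t ≤ m.rational m.α₁ t ∧ m.rational m.α₁ t < m.rational m.α₂ t) ∧
      (m.α₁ ≠ m.α₂ →
        |Pinf t - m.rational m.α₂ t| > |Pinf t - m.rational m.α₁ t|) := by
  have hasym := m.isAsymptotic hT hσ hα₁ hW
  refine ⟨⟨_, hasym⟩, fun Pinf hP t ht => ?_⟩
  have heq : Pinf t = m.rational m.α₁ t + m.imitation t := hP.eqOn hasym ht
  have hlt : m.α₁ < m.α₂ →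
      Pinf t ≥ m.rational m.α₁ t ∧ m.rational m.α₁ t > m.rational m.α₂ t := fun h => by
    have h1 := m.imitation_nonneg hT (sub_nonneg.2 (m.div_lt_div_of_lt hv hσ hα₁ h).le) ht
    exact ⟨by linarith, m.rational_lt_of_lt hv hσ hα₁ h t⟩
  have hgt : m.α₁ > m.α₂ →
      Pinf t ≤ m.rational m.α₁ t ∧ m.rational m.α₁ t < m.rational m.α₂ t := fun h => by
    have h1 := m.imitation_nonpos hT (sub_nonpos.2 (m.div_lt_div_of_lt hv hσ hα₂ h).le) ht
    exact ⟨by linarith, m.rational_lt_of_lt hv hσ hα₂ h t⟩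
  refine ⟨hlt, hgt, fun hne => ?_⟩
  -- In both cases `rational α₁` lies between `rational α₂` and the limit, at positive distance from
  -- `rational α₂`.
  rcases lt_or_gt_of_ne hne with h | h
  · obtain ⟨h1, h2⟩ := hlt h
    rw [gt_iff_lt, abs_of_nonneg (by linarith), abs_of_nonneg (by linarith)]
    linarith
  · obtain ⟨h1, h2⟩ := hgt h
    rw [gt_iff_lt, abs_of_nonpos (by linarith), abs_of_nonpos (by linarith)]
    linarith
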